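/- **Setting.** Let $\mathcal G=(\mathcal V,\mathcal E)$ be a finite simple undirected graph without isolated nodes, with adjacency matrix $A$, diagonal degree matrix $D=\operatorname{diag}(d_v)$ and $\operatorname{vol}(S)=\sum_{v\in S}d_v$. Let $\alpha\in(0,1)$, $s\in\mathcal V$, $0<\epsilon\le 1/d_s$. Put $W=D^{-1/2}AD^{-1/2}=V\Lambda V^\top$ (any orthogonal eigendecomposition, $\Lambda=\operatorname{diag}(\lambda_i)$), $Q=I-\frac{1-\alpha}{1+\alpha}W$, $b=\frac{2\alpha}{1+\alpha}D^{-1/2}e_s$, $\delta_0=0$, $\delta_1=\frac{1-\alpha}{1+\alpha}$, $\delta_{t+1}=\big(2\frac{1+\alpha}{1-\alpha}-\delta_t\big)^{-1}$ for $t\ge1$, and $\delta_{j:t}=\prod_{i=j}^t\delta_i$ (empty products are $1$). For a vector $v$ and $S\subseteq\mathcal V$, $v_S$ agrees with $v$ on $S$ and is $0$ elsewhere. The local Chebyshev method LocCH generates $x^{(0)}=0$, $x^{(1)}=r^{(0)}$ and, for $t\ge1$, $$x^{(t+1)}=x^{(t)}+(1+\delta_t\delta_{t+1})\,r^{(t)}_{S_t}+\delta_t\delta_{t+1}\big(x^{(t)}-x^{(t-1)}\big)_{S_t},$$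 where $r^{(t)}=b-Qx^{(t)}$ and $S_t=\{u:|r^{(t)}_u|\ge 2\alpha\epsilon\sqrt{d_u}/(1+\alpha)\}$. It stops at the first $T$ with $S_T=\emptyset$, if there is one, and returns $x^{(T)},r^{(T)}$. Its runtime is $\mathcal T=\sum_{t<T}\operatorname{vol}(S_t)$, and $\overline{\operatorname{vol}}(S_T)=\frac1T\sum_{t<T}\operatorname{vol}(S_t)$. For $k\le j$ let $S_{k,j}=S_k\cap\dots\cap S_{j-1}\cap(\mathcal V\setminus S_j)$. For $j<t$ let $H_{j,t}$ be the diagonal matrix whose $i$-th entry is $\frac{\sin(\theta_i(t-j))}{\sin\theta_i}$ with $\theta_i=\arccos\lambda_i$ if $|\lambda_i|<1$, $t-j$ if $\lambda_i=1$, and $(-1)^{t-j-1}(t-j)$ if $\lambda_i=-1$. For $k<t$ let $$u_{0,t}=\sum_{j=1}^{t-1}\tfrac{\delta_{2:j}}{t}H_{j,t}\big(I-\tfrac{1-\alpha}{1+\alpha}\Lambda\big)V^\top r^{(0)}_{S_{0,j}},\qquad u_{k,t}=\sum_{j=k}^{t-1}\tfrac{\delta_{k+1:j}}{t-k}H_{j,t}\big(\tfrac{1+\alpha}{1-\alpha}I-\Lambda\big)V^\top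 r^{(k)}_{S_{k,j}}\quad(k\ge1),$$ and $\beta_{k,t}=\|u_{k,t}\|_2/\|r^{(k)}\|_2$ (read as $0$ if $r^{(k)}=0$). Fix a horizon $N\in\mathbb N\cup\{\infty\}$ and let $\beta_k=\sup_{k<t\le N}\beta_{k,t}$ be the running residual reduction rates (with $\beta_k=0$ if there is no such $t$). Let $y_0=y_1=\|r^{(0)}\|_2$ and $y_{t+1}-2y_t+\frac{y_{t-1}}{(1+\beta_{t-1})(1+\beta_t)}=0$ for $t\ge1$. **Theorem (Runtime bound of LocCH).** 1. (Whether or not the method stops.) The suprema $\beta_k$ are finite, all $y_t$ are positive, and for all $t$ with $1\le t\le N$ $$\|r^{(t)}\|_2\le\delta_{1:t}\prod_{j=0}^{t-1}(1+\beta_j)\;y_t .$$ 2. There are an absolute constant $C>0$ and one program $P$ for a real random access machine with adjacency-list access to the graph (real arithmetic including square roots, arrays indexed by nodes that are initially zero, FIFO queues of nodes), the same for all inputs, such that whenever LocCH stops at some $T$, $P$ on input $(\alpha,\epsilon,s,\mathcal G)$ halts with output $x^{(T)},r^{(T)}$ after at most $C\,\mathcal T$ elementary steps. Moreover there are $\epsilon_0>0$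 and $L$ depending only on $\alpha$ such that the following holds. Suppose that LocCH stops at $T$, that $T\le N$, and that the geometric mean $\overline\beta_T=\big(\prod_{j=0}^{T-1}(1+\beta_j)\big)^{1/T}$ equals $1+\frac{c\sqrt\alpha}{1-\sqrt\alpha}$ with $c\in[0,2)$. Then, if $\epsilon\le\epsilon_0$, both $\mathcal T$ and the number of steps of $P$ are at most $$C\cdot\frac{(1+\sqrt\alpha)\,\overline{\operatorname{vol}}(S_T)}{\sqrt\alpha\,(2-c)}\,\ln\frac{2y_T}{\epsilon},$$ and for every $\epsilon\in(0,1/d_s]$ $$\mathcal T\le\frac{(1+\sqrt\alpha)\,\overline{\operatorname{vol}}(S_T)}{\sqrt\alpha\,(2-c)}\Big(\ln\frac{2y_T}{\epsilon}+L\Big).$$ -/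

import Mathlib

open Finset
open scoped Matrix

namespace LocCH

noncomputable section

/-! ### The linear system -/

section System

variable {V : Type*} [Fintype V] [DecidableEq V]

/-- The Euclidean norm of a vector indexed by a finite type. -/
def l2 (v : V → ℝ) : ℝ := ‖WithLp.toLp 2 v‖

/-- `v_S`: the vector that agrees with `v` on `S` and vanishes off `S`. -/
def restrict (S : Finset V) (v : V → ℝ) : V → ℝ := fun u => if u ∈ S then v u else 0

variable (G : SimpleGraph V) [DecidableRel G.Adj]

/-- `D^{-1/2}`, with `D` the diagonal matrix of degrees. -/
def invSqrtDeg : Matrix V V ℝ := Matrix.diagonal fun v => (Real.sqrt (G.degree v))⁻¹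

/-- The normalized adjacency matrix `W = D^{-1/2} A D^{-1/2}`. -/
def normAdj : Matrix V V ℝ := invSqrtDeg G * G.adjMatrix ℝ * invSqrtDeg G

/-- `Q = I - (1-α)/(1+α) W`. -/
def matQ (α : ℝ) : Matrix V V ℝ := 1 - ((1 - α) / (1 + α)) • normAdj G

/-- `b = 2α/(1+α) D^{-1/2} e_s`. -/
def vecB (α : ℝ) (s : V) : V → ℝ := (2 * α / (1 + α)) • (invSqrtDeg G *ᵥ Pi.single s 1)

/-- The volume of a set of nodes: the sum of the degrees. -/
def vol (S : Finset V) : ℕ := ∑ v ∈ S, G.degree v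

end System

/-! ### The Chebyshev coefficients -/

/-- `δ_0 = 0`, `δ_1 = (1-α)/(1+α)`, `δ_{t+1} = (2(1+α)/(1-α) - δ_t)⁻¹` for `t ≥ 1`. -/
def delta (α : ℝ) : ℕ → ℝ
  | 0 => 0
  | 1 => (1 - α) / (1 + α)
  | t + 2 => (2 * ((1 + α) / (1 - α)) - delta α (t + 1))⁻¹

/-- `δ_{j:t} = δ_j δ_{j+1} ⋯ δ_t`, the empty product being `1`. -/
def deltaProd (α : ℝ) (j t : ℕ) : ℝ := ∏ i ∈ Icc j t, delta α i

/-! ### The local Chebyshev method as a locally evolving set process -/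

section Evolution

variable {V : Type*} [Fintype V] [DecidableEq V] (G : SimpleGraph V) [DecidableRel G.Adj]
  (α ε : ℝ) (s : V)

/-- The residual `b - Q x` of a vector `x`. -/
def residual (x : V → ℝ) : V → ℝ := vecB G α s - matQ G α *ᵥ x

open Classical in
/-- The set of active nodes for a residual `r`: `|r_u| ≥ 2αε √d_u / (1+α)`. -/
def activeOf (r : V → ℝ) : Finset V :=
  univ.filter fun u => 2 * α * ε * Real.sqrt (G.degree u) / (1 + α) ≤ |r u|

/-- The iterates `x^(t)`: `x^(0) = 0`, `x^(1) = r^(0)`, and for `t ≥ 1`, with `S_t` the active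
nodes of `r^(t) = b - Q x^(t)`,
`x^(t+1) = x^(t) + (1 + δ_t δ_{t+1}) r^(t)_{S_t} + δ_t δ_{t+1} (x^(t) - x^(t-1))_{S_t}`. -/
def iter : ℕ → V → ℝ
  | 0 => 0
  | 1 => residual G α s 0
  | t + 2 =>
    iter (t + 1) +
      ((1 + delta α (t + 1) * delta α (t + 2)) •
          restrict (activeOf G α ε (residual G α s (iter (t + 1))))
            (residual G α s (iter (t + 1))) +
        (delta α (t + 1) * delta α (t + 2)) •
          restrict (activeOf G α ε (residual G α s (iter (t + 1))))
            (iter (t + 1) - iter t))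

/-- The residual `r^(t)`. -/
def res (t : ℕ) : V → ℝ := residual G α s (iter G α ε s t)

/-- The active set `S_t`. -/
def active (t : ℕ) : Finset V := activeOf G α ε (res G α ε s t)

/-- The update of the residual that the method performs at each step is the one that
`r^(t) = b - Q x^(t)` dictates. -/
theorem res_succ (t : ℕ) :
    res G α ε s (t + 1) = res G α ε s t - (iter G α ε s (t + 1) - iter G α ε s t) +
      ((1 - α) / (1 + α)) • (normAdj G *ᵥ (iter G α ε s (t + 1) - iter G α ε s t)) := by
  simp only [res, residual, matQ, Matrix.sub_mulVec, Matrix.one_mulVec, Matrix.smul_mulVec,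
    Matrix.mulVec_sub, smul_sub]
  abel

/-- The runtime `∑_{t<T} vol(S_t)` of the process. -/
def runtime (T : ℕ) : ℝ := ∑ t ∈ range T, (vol G (active G α ε s t) : ℝ)

/-- The average volume `(1/T) ∑_{t<T} vol(S_t)` of the active sets. -/
def avgVol (T : ℕ) : ℝ := (1 / (T : ℝ)) * ∑ t ∈ range T, (vol G (active G α ε s t) : ℝ)

/-- `S_{k,j} = S_k ∩ ⋯ ∩ S_{j-1} ∩ (V ∖ S_j)` for `j ≥ k`. -/
def window (k j : ℕ) : Finset V :=
  univ.filter fun u => (∀ i ∈ Ico k j, u ∈ active G α ε s i) ∧ u ∉ active G α ε s j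

end Evolution

/-! ### Residual reduction rates -/

/-- The entry of `H_{j,t}` at an eigenvalue `l`, with `m = t - j ≥ 1`: it is
`sin(θ m) / sin θ`, `θ = arccos l`, if `|l| < 1`, with the limits at `l = 1` and `l = -1`. -/
def hEntry (m : ℕ) (l : ℝ) : ℝ :=
  if l = 1 then m
  else if l = -1 then (-1) ^ (m - 1) * m
  else Real.sin (Real.arccos l * m) / Real.sin (Real.arccos l)

section Rates

variable {V : Type*} [Fintype V] [DecidableEq V] (G : SimpleGraph V) [DecidableRel G.Adj]
  (α ε : ℝ) (s : V)

/-- `W = E Λ Eᵀ`, with `E` orthogonal and `Λ = diag(lam)`, is an eigendecomposition of the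
normalized adjacency matrix. -/
def IsEigendecomposition (E : Matrix V V ℝ) (lam : V → ℝ) : Prop :=
  E * Eᵀ = 1 ∧ Eᵀ * E = 1 ∧ normAdj G = E * Matrix.diagonal lam * Eᵀ

variable (E : Matrix V V ℝ) (lam : V → ℝ)

/-- The diagonal matrix `H_{j,t}`. -/
def matH (j t : ℕ) : Matrix V V ℝ := Matrix.diagonal fun i => hEntry (t - j) (lam i)

/-- The vector `u_{k,t}`, for `k < t`:
`u_{0,t} = ∑_{j=1}^{t-1} (δ_{2:j}/t) H_{j,t} (I - (1-α)/(1+α) Λ) Eᵀ r^(0)_{S_{0,j}}`, and for `k ≥ 1`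
`u_{k,t} = ∑_{j=k}^{t-1} (δ_{k+1:j}/(t-k)) H_{j,t} ((1+α)/(1-α) I - Λ) Eᵀ r^(k)_{S_{k,j}}`. -/
def vecU (k t : ℕ) : V → ℝ :=
  if k = 0 then
    ∑ j ∈ Ico 1 t, (deltaProd α 2 j / (t : ℝ)) •
      (matH lam j t *ᵥ ((1 - ((1 - α) / (1 + α)) • Matrix.diagonal lam) *ᵥ
        (Eᵀ *ᵥ restrict (window G α ε s 0 j) (res G α ε s 0))))
  else
    ∑ j ∈ Ico k t, (deltaProd α (k + 1) j / ((t : ℝ) - (k : ℝ))) •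
      (matH lam j t *ᵥ ((((1 + α) / (1 - α)) • (1 : Matrix V V ℝ) - Matrix.diagonal lam) *ᵥ
        (Eᵀ *ᵥ restrict (window G α ε s k j) (res G α ε s k))))

/-- `β_{k,t} = ‖u_{k,t}‖₂ / ‖r^(k)‖₂`. -/
def betaAt (k t : ℕ) : ℝ := l2 (vecU G α ε s E lam k t) / l2 (res G α ε s k)

/-- The running residual reduction rate `β_k = sup_t β_{k,t}`, over the `t` with `k < t ≤ N`,
where `N ∈ ℕ ∪ {∞}` is the number of iterations taken into account
(`0` if there is no such `t`). -/
def beta (N : ℕ∞) (k : ℕ) : ℝ :=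
  ⨆ t : {t : ℕ // k < t ∧ (t : ℕ∞) ≤ N}, betaAt G α ε s E lam k t.1

end Rates

/-- The solution of `y_{t+1} - 2 y_t + y_{t-1} / ((1+β_{t-1})(1+β_t)) = 0`, `t ≥ 1`,
with `y_0 = y_1 = c`. -/
def ySeq (β : ℕ → ℝ) (c : ℝ) : ℕ → ℝ
  | 0 => c
  | 1 => c
  | t + 2 => 2 * ySeq β c (t + 1) - ySeq β c t / ((1 + β t) * (1 + β (t + 1)))

/-- The geometric mean `(∏_{j<t} (1+β_j))^{1/t}`. -/
def geomMean (β : ℕ → ℝ) (t : ℕ) : ℝ := (∏ j ∈ range t, (1 + β j)) ^ (1 / (t : ℝ))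

end

/-! ### A real random access machine on graphs, with a step count

Programs do not depend on the graph. They handle real registers, pointers to nodes, real arrays
indexed by nodes (initially zero) and FIFO queues of nodes, and they access the graph only through
adjacency lists. -/

/-- Real expressions: constants, a register, the entry of array `a` at the node that pointer `p`
points to, the degree of that node, and arithmetic operations. -/
inductive Expr : Type
  | const (n : ℕ)
  | reg (i : ℕ)
  | arr (a p : ℕ)
  | deg (p : ℕ)
  | add (e f : Expr)
  | sub (e f : Expr)
  | mul (e f : Expr)
  | div (e f : Expr)
  | sqrt (e : Expr)
  | abs (e : Expr)

/-- The cost of evaluating an expression: its number of nodes. -/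
def Expr.cost : Expr → ℕ
  | .const _ => 1
  | .reg _ => 1
  | .arr _ _ => 1
  | .deg _ => 1
  | .add e f => e.cost + f.cost + 1
  | .sub e f => e.cost + f.cost + 1
  | .mul e f => e.cost + f.cost + 1
  | .div e f => e.cost + f.cost + 1
  | .sqrt e => e.cost + 1
  | .abs e => e.cost + 1

/-- Programs. -/
inductive Prog : Type
  /-- do nothing -/
  | skip
  /-- write the value of `e` to register `i` -/
  | setReg (i : ℕ) (e : Expr)
  /-- write the value of `e` to array `a`, at the node of pointer `p` -/
  | setArr (a p : ℕ) (e : Expr)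
  /-- enqueue the node of pointer `p` in queue `q` -/
  | push (q p : ℕ)
  /-- dequeue a node from queue `q`, which must be nonempty, and let pointer `p` point to it -/
  | pop (q p : ℕ)
  /-- enqueue all neighbours of the node of pointer `p` in queue `q`, one after the other -/
  | pushNbrs (q p : ℕ)
  /-- run two programs in succession -/
  | seq (P P' : Prog)
  /-- branch according to whether `e ≤ f` -/
  | ite (e f : Expr) (P P' : Prog)
  /-- repeat `P` as long as queue `q` is nonempty -/
  | loop (q : ℕ) (P : Prog)

/-- Memory states. -/
structure Mem (V : Type*) where
  reg : ℕ → ℝ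
  ptr : ℕ → V
  arr : ℕ → V → ℝ
  queue : ℕ → List V

noncomputable section

variable {V : Type*}

/-- The value of an expression, in a graph given by the adjacency lists `nb`. -/
def Expr.eval (nb : V → List V) (σ : Mem V) : Expr → ℝ
  | .const n => n
  | .reg i => σ.reg i
  | .arr a p => σ.arr a (σ.ptr p)
  | .deg p => (nb (σ.ptr p)).length
  | .add e f => e.eval nb σ + f.eval nb σ
  | .sub e f => e.eval nb σ - f.eval nb σ
  | .mul e f => e.eval nb σ * f.eval nb σ
  | .div e f => e.eval nb σ / f.eval nb σ
  | .sqrt e => Real.sqrt (e.eval nb σ)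
  | .abs e => |e.eval nb σ|

/-- `Run nb P σ τ n`: the program `P`, started in memory state `σ`, halts in memory state `τ` after
`n` steps. -/
inductive Run [DecidableEq V] (nb : V → List V) : Prog → Mem V → Mem V → ℕ → Prop
  | skip (σ : Mem V) : Run nb .skip σ σ 1
  | setReg (i : ℕ) (e : Expr) (σ : Mem V) :
      Run nb (.setReg i e) σ { σ with reg := Function.update σ.reg i (e.eval nb σ) } (e.cost + 1)
  | setArr (a p : ℕ) (e : Expr) (σ : Mem V) :
      Run nb (.setArr a p e) σ
        { σ with arr := Function.update σ.arr a
                    (Function.update (σ.arr a) (σ.ptr p) (e.eval nb σ)) } (e.cost + 1)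
  | push (q p : ℕ) (σ : Mem V) :
      Run nb (.push q p) σ
        { σ with queue := Function.update σ.queue q (σ.queue q ++ [σ.ptr p]) } 1
  | pop (q p : ℕ) (σ : Mem V) (v : V) (l : List V) (h : σ.queue q = v :: l) :
      Run nb (.pop q p) σ
        { σ with ptr := Function.update σ.ptr p v, queue := Function.update σ.queue q l } 1
  | pushNbrs (q p : ℕ) (σ : Mem V) :
      Run nb (.pushNbrs q p) σ
        { σ with queue := Function.update σ.queue q (σ.queue q ++ nb (σ.ptr p)) }
        ((nb (σ.ptr p)).length + 1)
  | seq (P P' : Prog) (σ τ ρ : Mem V) (m n : ℕ) (h : Run nb P σ τ m) (h' : Run nb P' τ ρ n) :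
      Run nb (.seq P P') σ ρ (m + n)
  | iteTrue (e f : Expr) (P P' : Prog) (σ τ : Mem V) (n : ℕ) (hc : e.eval nb σ ≤ f.eval nb σ)
      (h : Run nb P σ τ n) : Run nb (.ite e f P P') σ τ (e.cost + f.cost + 1 + n)
  | iteFalse (e f : Expr) (P P' : Prog) (σ τ : Mem V) (n : ℕ) (hc : ¬ e.eval nb σ ≤ f.eval nb σ)
      (h : Run nb P' σ τ n) : Run nb (.ite e f P P') σ τ (e.cost + f.cost + 1 + n)
  | loopDone (q : ℕ) (P : Prog) (σ : Mem V) (h : σ.queue q = []) : Run nb (.loop q P) σ σ 1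
  | loopStep (q : ℕ) (P : Prog) (σ τ ρ : Mem V) (m n : ℕ) (hq : σ.queue q ≠ [])
      (h : Run nb P σ τ m) (h' : Run nb (.loop q P) τ ρ n) : Run nb (.loop q P) σ ρ (m + n + 1)

/-- The initial memory: `α` in register `0`, `ε` in register `1`, all pointers at `s`, and
everything else zero or empty. -/
def initMem (α ε : ℝ) (s : V) : Mem V where
  reg := fun i => if i = 0 then α else if i = 1 then ε else 0
  ptr := fun _ => s
  arr := fun _ _ => 0
  queue := fun _ => []

/-- `nb` lists, in some order and without repetition, the neighbours of each node of `G`. -/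
def IsAdjList (G : SimpleGraph V) (nb : V → List V) : Prop :=
  ∀ u, (nb u).Nodup ∧ ∀ v, v ∈ nb u ↔ G.Adj u v

/-- The program `P` implements the local Chebyshev method for the configuration `(α, ε, s, G)`, with
`T` iterations and within `n` steps: whatever the order of the adjacency lists, it halts after at
most `n` steps with `x^(T)` in array `0` and `r^(T)` in array `1`. -/
def Implements (P : Prog) [Fintype V] [DecidableEq V] (G : SimpleGraph V) [DecidableRel G.Adj]
    (α ε : ℝ) (s : V) (T : ℕ) (n : ℝ) : Prop :=
  ∀ nb : V → List V, IsAdjList G nb → ∃ (τ : Mem V) (m : ℕ),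
    Run nb P (initMem α ε s) τ m ∧ τ.arr 0 = iter G α ε s T ∧ τ.arr 1 = res G α ε s T ∧
      (m : ℝ) ≤ n

end

end LocCH

/-! LocCH is the Chebyshev iteration with each update cut down to `S_t`. Its residual therefore
obeys the Chebyshev three-term recurrence with a forcing term, namely `Q` applied to the discarded
part of the full update (`res_add_two`). Unrolling the momentum writes the full update as a
combination of earlier residuals `r^(k)`, each restricted to the nodes active ever since time `k`;
off the current active set these restrictions become the windows `S_{k,j}`
(`restrict_compl_fullStep`).

In an eigenbasis of `W`, after division by `δ_{1:t}`, each coordinate satisfies `w_{t+1} = 2λ w_t -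
w_{t-1} + F_t`. Variation of constants, with kernel `U_{t-j-1}(λ)` (the entries of `H_{j,t}`), gives
`T_t(λ) w_0` plus the coordinates of `t u_{0,t} + 2 ∑ (t-k) u_{k,t} / δ_{1:k}`
(`scaled_residual_eq`). Taking norms, `a_t = ‖r^(t)‖ / δ_{1:t}` satisfies the Volterra inequality
`a_t ≤ a_0 (1 + t β_0) + 2 ∑ (t-k) β_k a_k`. Its kernel is nonnegative, so `a` lies below the
solution of the corresponding equation, which is `Y_t = ∏ (1+β_j) y_t` (`majorant_eq`,
`le_majorant`).

For the runtime, some node is still active at time `T-1`, which bounds the residual from below,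
while `δ_{1:t} ≤ 2ρ^t` with `ρ = (1-√α)/(1+√α)`. If `γ` is the geometric mean, `ργ = 1 -
(2-c)√α/(1+√α)`, so the residual bound decays exponentially and limits `T` (`iterations_le`).

The program relies on locality: an inactive node without active neighbours keeps its residual, so
the next active set lies among the active nodes and their neighbours. One iteration then costs
`O(vol(S_t))` (`terminates_iterationBody`). -/

namespace LocCH

/-! ### Chebyshev coefficients and their decay -/

section Coefficients

variable {α : ℝ}

lemma contraction_pos (h0 : 0 < α) (h1 : α < 1) : 0 < (1 - α) / (1 + α) :=
  div_pos (by linarith) (by linarith)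

lemma contraction_lt_one (h0 : 0 < α) : (1 - α) / (1 + α) < 1 := by
  rw [div_lt_one (by linarith)]; linarith

lemma delta_mem_Ioc (h0 : 0 < α) (h1 : α < 1) (t : ℕ) :
    delta α (t + 1) ∈ Set.Ioc 0 ((1 - α) / (1 + α)) := by
  have hq := contraction_pos h0 h1
  have hq1 := contraction_lt_one h0
  induction t with
  | zero => exact ⟨hq, le_rfl⟩
  | succ t ih =>
    obtain ⟨ih0, ih1⟩ := ih
    have hinv : (1 + α) / (1 - α) = ((1 - α) / (1 + α))⁻¹ := (inv_div _ _).symm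
    have h2 : 1 ≤ ((1 - α) / (1 + α))⁻¹ := (one_le_inv₀ hq).2 hq1.le
    have key : ((1 - α) / (1 + α))⁻¹ ≤ 2 * ((1 + α) / (1 - α)) - delta α (t + 1) := by
      rw [hinv]; linarith
    have hpos : 0 < ((1 - α) / (1 + α))⁻¹ := inv_pos.2 hq
    refine ⟨?_, ?_⟩
    · show 0 < (2 * ((1 + α) / (1 - α)) - delta α (t + 1))⁻¹
      exact inv_pos.2 (hpos.trans_le key)
    · show (2 * ((1 + α) / (1 - α)) - delta α (t + 1))⁻¹ ≤ _
      exact inv_le_of_inv_le₀ hq key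

lemma delta_pos (h0 : 0 < α) (h1 : α < 1) (t : ℕ) : 0 < delta α (t + 1) :=
  (delta_mem_Ioc h0 h1 t).1

/-- The recursion of `delta` with its denominator cleared. It is what cancels the multiples of
`r^(t+1)` not involving `W` in `res_add_two`. -/
lemma one_add_delta_mul_delta (h0 : 0 < α) (h1 : α < 1) (t : ℕ) :
    1 + delta α (t + 1) * delta α (t + 2) = 2 * ((1 + α) / (1 - α)) * delta α (t + 2) := by
  have h := delta_pos h0 h1 (t + 1)
  have h2 : delta α (t + 2) * (2 * ((1 + α) / (1 - α)) - delta α (t + 1)) = 1 := by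
    have : delta α (t + 2) = (2 * ((1 + α) / (1 - α)) - delta α (t + 1))⁻¹ := rfl
    rw [this] at h ⊢
    exact inv_mul_cancel₀ (inv_pos.1 h).ne'
  linear_combination -h2

lemma deltaProd_succ {j t : ℕ} (h : j ≤ t + 1) :
    deltaProd α j (t + 1) = deltaProd α j t * delta α (t + 1) :=
  prod_Icc_succ_top h _

lemma deltaProd_of_lt {j t : ℕ} (h : t < j) : deltaProd α j t = 1 := by
  simp [deltaProd, Icc_eq_empty_of_lt h]

lemma deltaProd_pos (h0 : 0 < α) (h1 : α < 1) {j : ℕ} (hj : 1 ≤ j) (t : ℕ) :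
    0 < deltaProd α j t := by
  refine prod_pos fun i hi => ?_
  obtain ⟨i, rfl⟩ := Nat.exists_eq_add_of_le' (hj.trans (mem_Icc.1 hi).1)
  exact delta_pos h0 h1 i

lemma deltaProd_le (h0 : 0 < α) (h1 : α < 1) {j : ℕ} (hj : 1 ≤ j) (t : ℕ) :
    deltaProd α j t ≤ ((1 - α) / (1 + α)) ^ (t + 1 - j) := by
  rw [deltaProd, ← Nat.card_Icc, ← prod_const]
  refine prod_le_prod (fun i hi => ?_) fun i hi => ?_ <;>
  obtain ⟨i, rfl⟩ := Nat.exists_eq_add_of_le' (hj.trans (mem_Icc.1 hi).1)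
  · exact (delta_pos h0 h1 i).le
  · exact (delta_mem_Ioc h0 h1 i).2

/-- The product is the reciprocal of the Chebyshev polynomial `T_n` at `(1+α)/(1-α) = (ρ + ρ⁻¹)/2`,
that is, of `(ρ^n + ρ^{-n})/2 ≥ ρ^{-n}/2`. -/
lemma deltaProd_one_le (h0 : 0 < α) (h1 : α < 1) (n : ℕ) :
    deltaProd α 1 n ≤ 2 * ((1 - √α) / (1 + √α)) ^ n := by
  have hs0 : 0 < √α := Real.sqrt_pos.2 h0
  have hs1 : √α < 1 := by
    rw [Real.sqrt_lt' one_pos]; simpa using h1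
  have hsq : √α * √α = α := Real.mul_self_sqrt h0.le
  set ρ := (1 - √α) / (1 + √α) with hρ
  have hρ0 : 0 < ρ := div_pos (by linarith) (by linarith)
  have hsum : 2 * ((1 + α) / (1 - α)) = ρ + ρ⁻¹ := by
    have e1 : 1 - √α ≠ 0 := by linarith
    have e2 : 1 + √α ≠ 0 := by linarith
    have e3 : 1 - α = (1 - √α) * (1 + √α) := by linear_combination hsq
    rw [hρ, inv_div, e3]
    field_simp
    linear_combination -2 * hsq
  set c : ℕ → ℝ := fun n => (ρ ^ n + ρ⁻¹ ^ n) / 2 with hc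
  have hcpos : ∀ n, 0 < c n := fun n => by simp only [hc]; positivity
  have hrec : ∀ n, c (n + 2) = 2 * ((1 + α) / (1 - α)) * c (n + 1) - c n := fun n => by
    have : ρ * ρ⁻¹ = 1 := mul_inv_cancel₀ hρ0.ne'
    rw [hsum]; simp only [hc, pow_succ]
    linear_combination (-(ρ ^ n + ρ⁻¹ ^ n) / 2) * this
  have hδ : ∀ n, delta α (n + 1) * c (n + 1) = c n := by
    intro n
    induction n with
    | zero =>
      have hq := contraction_pos h0 h1
      have : c 1 = (1 + α) / (1 - α) := by simp only [hc, pow_one]; rw [← hsum]; ring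
      rw [this, ← inv_div (1 - α), show delta α (0 + 1) = (1 - α) / (1 + α) from rfl,
        mul_inv_cancel₀ hq.ne']
      simp [hc]
    | succ n ih =>
      linear_combination delta α (n + 2) * hrec n + delta α (n + 2) * ih -
        c (n + 1) * one_add_delta_mul_delta h0 h1 n
  have hprod : deltaProd α 1 n * c n = 1 := by
    induction n with
    | zero => rw [deltaProd_of_lt one_pos]; simp [hc]
    | succ n ih => rw [deltaProd_succ (by omega), mul_assoc, hδ, ih]
  have hinv : ρ ^ n * ρ⁻¹ ^ n = 1 := by rw [← mul_pow, mul_inv_cancel₀ hρ0.ne', one_pow]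
  have hge : 1 ≤ 2 * ρ ^ n * c n := by
    have : 0 ≤ ρ ^ n * ρ ^ n := by positivity
    simp only [hc]; linarith
  rw [← hprod] at hge
  exact le_of_mul_le_mul_right hge (hcpos n)

end Coefficients

/-! ### Euclidean norm estimates -/

section Norm

variable {V : Type*} [Fintype V]

lemma l2_eq_sqrt (v : V → ℝ) : l2 v = √(∑ i, v i ^ 2) := by
  simp [l2, EuclideanSpace.norm_eq]

lemma l2_nonneg (v : V → ℝ) : 0 ≤ l2 v := norm_nonneg _

lemma l2_zero : l2 (0 : V → ℝ) = 0 := by simp [l2]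

lemma l2_add_le (v w : V → ℝ) : l2 (v + w) ≤ l2 v + l2 w := by
  simpa [l2] using norm_add_le (WithLp.toLp 2 v) (WithLp.toLp 2 w)

lemma l2_smul (c : ℝ) (v : V → ℝ) : l2 (c • v) = |c| * l2 v := by
  simp [l2, norm_smul]

lemma l2_sum_le {ι : Type*} (s : Finset ι) (f : ι → V → ℝ) :
    l2 (∑ i ∈ s, f i) ≤ ∑ i ∈ s, l2 (f i) := by
  classical
  induction s using Finset.induction_on with
  | empty => simp [l2_zero]
  | insert a s ha ih =>
    rw [sum_insert ha, sum_insert ha]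
    exact (l2_add_le _ _).trans (by gcongr)

lemma l2_le_of_abs_le {v w : V → ℝ} {c : ℝ} (hc : 0 ≤ c) (h : ∀ i, |v i| ≤ c * |w i|) :
    l2 v ≤ c * l2 w := by
  rw [l2_eq_sqrt, l2_eq_sqrt, ← Real.sqrt_sq hc, ← Real.sqrt_mul (sq_nonneg c), mul_sum]
  refine Real.sqrt_le_sqrt (sum_le_sum fun i _ => ?_)
  rw [← mul_pow, ← sq_abs (v i), ← sq_abs (c * w i), abs_mul, abs_of_nonneg hc]
  exact pow_le_pow_left₀ (abs_nonneg _) (h i) 2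

lemma abs_apply_le_l2 (v : V → ℝ) (i : V) : |v i| ≤ l2 v := by
  rw [l2_eq_sqrt, ← Real.sqrt_sq_eq_abs]
  exact Real.sqrt_le_sqrt (single_le_sum (f := fun i => v i ^ 2) (fun i _ => sq_nonneg _)
    (mem_univ i))

variable [DecidableEq V]

lemma l2_diagonal_mulVec_le {a : V → ℝ} {c : ℝ} (hc : 0 ≤ c) (h : ∀ i, |a i| ≤ c) (v : V → ℝ) :
    l2 (Matrix.diagonal a *ᵥ v) ≤ c * l2 v := by
  refine l2_le_of_abs_le hc fun i => ?_
  rw [Matrix.mulVec_diagonal, abs_mul]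
  exact mul_le_mul_of_nonneg_right (h i) (abs_nonneg _)

lemma l2_restrict_le (S : Finset V) (v : V → ℝ) : l2 (restrict S v) ≤ l2 v := by
  rw [← one_mul (l2 v)]
  refine l2_le_of_abs_le zero_le_one fun i => ?_
  unfold restrict
  split_ifs <;> simp

lemma l2_transpose_mulVec {E : Matrix V V ℝ} (hE : E * Eᵀ = 1) (v : V → ℝ) :
    l2 (Eᵀ *ᵥ v) = l2 v := by
  have h : (Eᵀ *ᵥ v) ⬝ᵥ (Eᵀ *ᵥ v) = v ⬝ᵥ v := by
    rw [Matrix.dotProduct_mulVec, Matrix.vecMul_transpose, Matrix.mulVec_mulVec, hE,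
      Matrix.one_mulVec]
  simp only [dotProduct, ← pow_two] at h
  rw [l2_eq_sqrt, l2_eq_sqrt, h]

end Norm

/-! ### The spectrum of the normalized adjacency matrix -/

section Spectrum

variable {V : Type*} [Fintype V] [DecidableEq V] (G : SimpleGraph V) [DecidableRel G.Adj]

lemma normAdj_mulVec (x : V → ℝ) (v : V) :
    (normAdj G *ᵥ x) v =
      (√(G.degree v))⁻¹ * ∑ u ∈ G.neighborFinset v, (√(G.degree u))⁻¹ * x u := by
  rw [normAdj, ← Matrix.mulVec_mulVec, ← Matrix.mulVec_mulVec, invSqrtDeg,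
    Matrix.mulVec_diagonal, SimpleGraph.adjMatrix_mulVec_apply]
  simp [Matrix.mulVec_diagonal]

variable {G}

/-- For `z = D^{-1/2} x` the equation says that `l z_v` is the average of `z` over the neighbours of
`v`. Evaluate at a node where `|z|` is maximal. -/
lemma abs_le_one_of_normAdj_mulVec (hdeg : ∀ v, 0 < G.degree v) {x : V → ℝ} (hx : x ≠ 0) {l : ℝ}
    (h : normAdj G *ᵥ x = l • x) : |l| ≤ 1 := by
  have hs : ∀ v, 0 < √(G.degree v : ℝ) := fun v => Real.sqrt_pos.2 (by exact_mod_cast hdeg v)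
  obtain ⟨i, hi⟩ := Function.ne_iff.1 hx
  obtain ⟨v, -, hv⟩ := exists_max_image univ (fun u => |(√(G.degree u))⁻¹ * x u|) ⟨i, mem_univ i⟩
  set m := |(√(G.degree v))⁻¹ * x v| with hm
  have hmpos : 0 < m := lt_of_lt_of_le
    (abs_pos.2 (mul_ne_zero (inv_ne_zero (hs i).ne') hi)) (hv i (mem_univ i))
  have hd : (0 : ℝ) < G.degree v := by exact_mod_cast hdeg v
  have hsum : |∑ u ∈ G.neighborFinset v, (√(G.degree u))⁻¹ * x u| ≤ G.degree v * m := by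
    refine (abs_sum_le_sum_abs _ _).trans ((sum_le_card_nsmul _ _ m fun u _ => hv u (mem_univ u)).trans
      ?_)
    simp
  have hval : ∑ u ∈ G.neighborFinset v, (√(G.degree u))⁻¹ * x u =
      G.degree v * (l * ((√(G.degree v))⁻¹ * x v)) := by
    have h1 := congrFun h v
    rw [normAdj_mulVec, Pi.smul_apply, smul_eq_mul] at h1
    have h2 : (G.degree v : ℝ) * (√(G.degree v))⁻¹ = √(G.degree v) := by
      rw [← div_eq_mul_inv, Real.div_sqrt]
    have h3 : √(G.degree v : ℝ) * (√(G.degree v))⁻¹ = 1 := mul_inv_cancel₀ (hs v).ne'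
    linear_combination √(G.degree v : ℝ) * h1 -
      (∑ u ∈ G.neighborFinset v, (√(G.degree u))⁻¹ * x u) * h3 - l * x v * h2
  rw [hval, abs_mul, abs_mul, ← hm, Nat.abs_cast] at hsum
  have := le_of_mul_le_mul_left hsum hd
  nlinarith

lemma IsEigendecomposition.mulVec_transpose {E : Matrix V V ℝ} {lam : V → ℝ}
    (h : IsEigendecomposition G E lam) (x : V → ℝ) (i : V) :
    (Eᵀ *ᵥ (normAdj G *ᵥ x)) i = lam i * (Eᵀ *ᵥ x) i := by
  rw [h.2.2, Matrix.mulVec_mulVec, ← mul_assoc, ← mul_assoc, h.2.1, one_mul, ← Matrix.mulVec_mulVec,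
    Matrix.mulVec_diagonal]

lemma IsEigendecomposition.abs_le_one (hdeg : ∀ v, 0 < G.degree v) {E : Matrix V V ℝ} {lam : V → ℝ}
    (h : IsEigendecomposition G E lam) (i : V) : |lam i| ≤ 1 := by
  refine abs_le_one_of_normAdj_mulVec hdeg (x := E *ᵥ Pi.single i 1) (fun h0 => ?_) ?_
  · have := congrArg (fun y => (Eᵀ *ᵥ y) i) h0
    rw [Matrix.mulVec_mulVec, h.2.1] at this
    simp at this
  · rw [h.2.2, Matrix.mulVec_mulVec, mul_assoc, h.2.1, mul_one, ← Matrix.mulVec_mulVec,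
      ← Matrix.mulVec_smul]
    congr 1
    ext j
    rw [Matrix.mulVec_diagonal]
    rcases eq_or_ne j i with rfl | hj
    · simp
    · simp [hj]

end Spectrum

/-! ### Chebyshev polynomials of the second kind -/

section ChebyshevEntries

lemma hEntry_zero (l : ℝ) : hEntry 0 l = 0 := by
  simp [hEntry]

lemma sin_arccos_pos {l : ℝ} (hl : |l| ≤ 1) (h1 : l ≠ 1) (h2 : l ≠ -1) :
    0 < Real.sin (Real.arccos l) := by
  rw [Real.sin_arccos]
  refine Real.sqrt_pos.2 ?_
  have hlt : |l| < 1 := lt_of_le_of_ne hl fun h => by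
    rcases eq_or_eq_neg_of_abs_eq h with h | h <;> contradiction
  have := (sq_lt_one_iff_abs_lt_one l).2 hlt
  linarith

lemma hEntry_one {l : ℝ} (hl : |l| ≤ 1) : hEntry 1 l = 1 := by
  unfold hEntry
  split_ifs with h1 h2
  · simp
  · simp
  · simpa using div_self (sin_arccos_pos hl h1 h2).ne'

/-- On `[-1, 1]` the entry is `U_{n-1}(l)`, with `U_{-1} = 0`; this is the recurrence of those
polynomials. -/
lemma hEntry_add_two {l : ℝ} (hl : |l| ≤ 1) (n : ℕ) :
    hEntry (n + 2) l = 2 * l * hEntry (n + 1) l - hEntry n l := by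
  unfold hEntry
  split_ifs with h1 h2
  · subst h1; push_cast; ring
  · subst h2
    rcases n with _ | n
    -- At `n = 0` the exponent `n - 1` is truncated, but the factor `n` vanishes.
    · norm_num
    · simp only [Nat.add_sub_cancel, show n + 1 + 2 - 1 = n + 2 from rfl,
        show n + 1 + 1 - 1 = n + 1 from rfl]
      push_cast; ring
  · have hc : Real.cos (Real.arccos l) = l := Real.cos_arccos (abs_le.1 hl).1 (abs_le.1 hl).2
    have hs := (sin_arccos_pos hl h1 h2).ne'
    set θ := Real.arccos l
    have e2 : θ * ((n + 2 : ℕ) : ℝ) = θ * ((n + 1 : ℕ) : ℝ) + θ := by push_cast; ring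
    have e0 : θ * (n : ℝ) = θ * ((n + 1 : ℕ) : ℝ) - θ := by push_cast; ring
    rw [e2, e0, Real.sin_add, Real.sin_sub, ← hc]
    field_simp
    ring

/-- By the sine addition formula each step adds at most `|sin θ|`. This bound is why the
denominators `t` and `t - k` keep the rates bounded. -/
lemma abs_hEntry_le {l : ℝ} (hl : |l| ≤ 1) (n : ℕ) : |hEntry n l| ≤ n := by
  unfold hEntry
  split_ifs with h1 h2
  · simp
  · simp [abs_mul, abs_pow]
  · have hs := sin_arccos_pos hl h1 h2
    rw [abs_div, div_le_iff₀ (abs_pos.2 hs.ne')]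
    set θ := Real.arccos l
    induction n with
    | zero => simp
    | succ n ih =>
      have e : θ * ((n + 1 : ℕ) : ℝ) = θ * (n : ℝ) + θ := by push_cast; ring
      rw [e, Real.sin_add]
      refine (abs_add_le _ _).trans ?_
      rw [abs_mul, abs_mul]
      have a1 := Real.abs_cos_le_one θ
      have a2 := Real.abs_cos_le_one (θ * n)
      have a3 := abs_nonneg (Real.sin (θ * n))
      have a4 := abs_nonneg (Real.sin θ)
      push_cast
      nlinarith

/-- Variation of constants for the three-term recurrence of the Chebyshev polynomials. -/
lemma chebyshev_variation_of_constants {l : ℝ} (hl : |l| ≤ 1) {w F : ℕ → ℝ} (h1 : w 1 = l * w 0)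
    (hw : ∀ t, w (t + 2) = 2 * l * w (t + 1) - w t + F (t + 1)) (t : ℕ) :
    w t = Real.cos (t * Real.arccos l) * w 0 + ∑ j ∈ Ico 1 t, hEntry (t - j) l * F j := by
  have hc : Real.cos (Real.arccos l) = l := Real.cos_arccos (abs_le.1 hl).1 (abs_le.1 hl).2
  induction t using Nat.twoStepInduction with
  | zero => simp
  | one => simp [hc, h1]
  | more t ih0 ih1 =>
    have hsum : ∑ j ∈ Ico 1 (t + 2), hEntry (t + 2 - j) l * F j =
        2 * l * ∑ j ∈ Ico 1 (t + 1), hEntry (t + 1 - j) l * F j -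
          ∑ j ∈ Ico 1 t, hEntry (t - j) l * F j + F (t + 1) := by
      -- The term `j = t` is free because `hEntry 0 l = 0`; the sums then share one range.
      have e0 : ∑ j ∈ Ico 1 t, hEntry (t - j) l * F j =
          ∑ j ∈ Ico 1 (t + 1), hEntry (t - j) l * F j := by
        rcases t with _ | t
        · simp
        · rw [sum_Ico_succ_top (by omega : 1 ≤ t + 1)]; simp [hEntry_zero]
      rw [sum_Ico_succ_top (by omega), e0, mul_sum, ← sum_sub_distrib]
      congr 1
      · refine sum_congr rfl fun j hj => ?_
        have hj := mem_Ico.1 hj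
        obtain ⟨m, hm⟩ := Nat.exists_eq_add_of_le (show j ≤ t by omega)
        subst hm
        rw [show j + m + 2 - j = m + 2 by omega, show j + m + 1 - j = m + 1 by omega,
          show j + m - j = m by omega, hEntry_add_two hl]
        ring
      · rw [show t + 2 - (t + 1) = 1 by omega, hEntry_one hl, one_mul]
    have hcos : Real.cos (((t + 2 : ℕ) : ℝ) * Real.arccos l) =
        2 * l * Real.cos (((t + 1 : ℕ) : ℝ) * Real.arccos l) -
          Real.cos ((t : ℝ) * Real.arccos l) := by
      set θ := Real.arccos l
      have e2 : ((t + 2 : ℕ) : ℝ) * θ = ((t + 1 : ℕ) : ℝ) * θ + θ := by push_cast; ring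
      have e0 : (t : ℝ) * θ = ((t + 1 : ℕ) : ℝ) * θ - θ := by push_cast; ring
      rw [e2, e0, Real.cos_add, Real.cos_sub, ← hc]
      ring
    rw [hw, hsum, hcos, ih0, ih1]
    ring

end ChebyshevEntries

lemma deltaProd_mul_deltaProd (α : ℝ) {k n : ℕ} (h : k ≤ n) :
    deltaProd α 1 k * deltaProd α (k + 1) n = deltaProd α 1 n := by
  induction n, h using Nat.le_induction with
  | base => rw [deltaProd_of_lt (Nat.lt_succ_self k), mul_one]
  | succ n h ih => rw [deltaProd_succ (by omega), deltaProd_succ (by omega), ← mul_assoc, ih]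

/-! ### The residual recurrence of the truncated iteration -/

section Evolution

variable {V : Type*} [Fintype V] [DecidableEq V] {G : SimpleGraph V} [DecidableRel G.Adj]
  {α ε : ℝ} {s : V}

omit [Fintype V] in
lemma restrict_apply (S : Finset V) (v : V → ℝ) (u : V) :
    restrict S v u = if u ∈ S then v u else 0 := rfl

lemma mem_active {t : ℕ} {u : V} : u ∈ active G α ε s t ↔
    2 * α * ε * √(G.degree u) / (1 + α) ≤ |res G α ε s t u| := by
  simp [active, activeOf]

variable (G α ε s) in
lemma res_zero : res G α ε s 0 = Pi.single s (2 * α / (1 + α) * (√(G.degree s))⁻¹) := by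
  have h : res G α ε s 0 = vecB G α s := by simp [res, residual, iter]
  rw [h]
  ext u
  rw [vecB, Pi.smul_apply, invSqrtDeg, Matrix.mulVec_diagonal, smul_eq_mul]
  rcases eq_or_ne u s with rfl | hu
  · simp
  · simp [hu]

/-- The initial residual lives at `s`, where it reaches the threshold exactly when `ε d_s ≤ 1`. -/
lemma active_zero (hdeg : ∀ v, 0 < G.degree v) (h0 : 0 < α) (hε0 : 0 < ε)
    (hε : ε ≤ 1 / (G.degree s : ℝ)) : active G α ε s 0 = {s} := by
  ext u
  have hd : ∀ v, 0 < √(G.degree v : ℝ) := fun v => Real.sqrt_pos.2 (by exact_mod_cast hdeg v)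
  rw [mem_active, mem_singleton, res_zero]
  rcases eq_or_ne u s with rfl | hu
  · simp only [Pi.single_eq_same, iff_true]
    have hdu := hd u
    refine le_trans ?_ (le_abs_self _)
    rw [le_div_iff₀ (by exact_mod_cast hdeg u)] at hε
    have hsq : √(G.degree u : ℝ) * √(G.degree u) = G.degree u :=
      Real.mul_self_sqrt (Nat.cast_nonneg _)
    have : ε * √(G.degree u) ≤ (√(G.degree u))⁻¹ := by
      rw [← one_div, le_div_iff₀ hdu, mul_assoc, hsq]
      exact hε
    calc 2 * α * ε * √(G.degree u) / (1 + α) = 2 * α / (1 + α) * (ε * √(G.degree u)) := by ring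
      _ ≤ _ := by gcongr
  · have := hd u
    simp only [hu, iff_false, not_le, Pi.single_eq_of_ne hu, abs_zero]
    positivity

/-- The update of `x^(t+1)` that the global method would make. -/
noncomputable def fullStep (G : SimpleGraph V) [DecidableRel G.Adj] (α ε : ℝ) (s : V) (t : ℕ) :
    V → ℝ :=
  (2 * ((1 + α) / (1 - α)) * delta α (t + 2)) • res G α ε s (t + 1) +
    (delta α (t + 1) * delta α (t + 2)) • (iter G α ε s (t + 1) - iter G α ε s t)

lemma iter_succ_sub (h0 : 0 < α) (h1 : α < 1) (t : ℕ) :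
    iter G α ε s (t + 2) - iter G α ε s (t + 1) =
      restrict (active G α ε s (t + 1)) (fullStep G α ε s t) := by
  have h : iter G α ε s (t + 2) = iter G α ε s (t + 1) +
      ((1 + delta α (t + 1) * delta α (t + 2)) •
          restrict (active G α ε s (t + 1)) (res G α ε s (t + 1)) +
        (delta α (t + 1) * delta α (t + 2)) •
          restrict (active G α ε s (t + 1)) (iter G α ε s (t + 1) - iter G α ε s t)) := rfl
  rw [h, add_sub_cancel_left, one_add_delta_mul_delta h0 h1]
  ext u
  by_cases hu : u ∈ active G α ε s (t + 1) <;> simp [restrict_apply, hu, fullStep]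

omit [Fintype V] in
lemma restrict_add (S : Finset V) (v w : V → ℝ) :
    restrict S (v + w) = restrict S v + restrict S w := by
  ext u
  by_cases hu : u ∈ S <;> simp [restrict_apply, hu]

omit [Fintype V] in
lemma restrict_smul (S : Finset V) (c : ℝ) (v : V → ℝ) :
    restrict S (c • v) = c • restrict S v := by
  ext u
  by_cases hu : u ∈ S <;> simp [restrict_apply, hu]

omit [Fintype V] in
lemma restrict_sum {ι : Type*} (S : Finset V) (I : Finset ι) (f : ι → V → ℝ) :
    restrict S (∑ i ∈ I, f i) = ∑ i ∈ I, restrict S (f i) := by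
  ext u
  by_cases hu : u ∈ S <;> simp [restrict_apply, hu]

lemma restrict_univ (v : V → ℝ) : restrict univ v = v := by
  ext u
  simp [restrict_apply]

/-- The intersection `S_k ∩ ⋯ ∩ S_{t-1}`. -/
noncomputable def persistent (G : SimpleGraph V) [DecidableRel G.Adj] (α ε : ℝ) (s : V) (k t : ℕ) :
    Finset V :=
  (Ico k t).inf (active G α ε s)

lemma persistent_self (k : ℕ) : persistent G α ε s k k = univ := by
  simp [persistent]

lemma restrict_persistent_succ {k t : ℕ} (h : k ≤ t) (v : V → ℝ) :
    restrict (persistent G α ε s k (t + 1)) v =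
      restrict (active G α ε s t) (restrict (persistent G α ε s k t) v) := by
  ext u
  simp only [persistent, Nat.Ico_succ_right_eq_insert_Ico h, inf_insert, restrict_apply,
    inf_eq_inter, mem_inter]
  by_cases hu : u ∈ active G α ε s t <;> simp [hu]

lemma restrict_compl_persistent (k t : ℕ) (v : V → ℝ) :
    restrict (active G α ε s t)ᶜ (restrict (persistent G α ε s k t) v) =
      restrict (window G α ε s k t) v := by
  ext u
  simp only [restrict_apply, window, persistent, mem_compl, mem_filter, mem_univ, true_and,
    Finset.mem_inf]
  by_cases hu : u ∈ active G α ε s t <;> simp [hu]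

lemma restrict_active_zero (hdeg : ∀ v, 0 < G.degree v) (h0 : 0 < α) (hε0 : 0 < ε)
    (hε : ε ≤ 1 / (G.degree s : ℝ)) :
    restrict (active G α ε s 0) (res G α ε s 0) = res G α ε s 0 := by
  rw [active_zero hdeg h0 hε0 hε, res_zero]
  ext u
  rcases eq_or_ne u s with rfl | hu <;> simp [restrict_apply, *]

lemma iter_one_sub : iter G α ε s 1 - iter G α ε s 0 = res G α ε s 0 := by
  simp [iter, res]

/-- The actual change is the full step restricted to the active set, and it enters the next full
step with a factor `δ_i δ_{i+1}`. So `r^(k)` survives only where all later sets have been active,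
and its coefficient collects these factors. -/
lemma fullStep_eq (hdeg : ∀ v, 0 < G.degree v) (h0 : 0 < α) (h1 : α < 1) (hε0 : 0 < ε)
    (hε : ε ≤ 1 / (G.degree s : ℝ)) (t : ℕ) :
    fullStep G α ε s t =
      (deltaProd α 1 (t + 1) * deltaProd α 2 (t + 2)) •
          restrict (persistent G α ε s 0 (t + 1)) (res G α ε s 0) +
        ∑ k ∈ Ico 1 (t + 2), (2 * ((1 + α) / (1 - α)) *
          (deltaProd α (k + 1) (t + 1) * deltaProd α (k + 1) (t + 2))) •
          restrict (persistent G α ε s k (t + 1)) (res G α ε s k) := by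
  induction t with
  | zero =>
    rw [restrict_persistent_succ le_rfl, persistent_self, restrict_univ,
      restrict_active_zero hdeg h0 hε0 hε, sum_Ico_succ_top (by omega), persistent_self,
      restrict_univ, fullStep, iter_one_sub]
    simp [deltaProd, add_comm]
  | succ t ih =>
    have hstep : fullStep G α ε s (t + 1) =
        (delta α (t + 2) * delta α (t + 3)) •
          restrict (active G α ε s (t + 1)) (fullStep G α ε s t) +
        (2 * ((1 + α) / (1 - α)) * delta α (t + 3)) • res G α ε s (t + 2) := by
      rw [← iter_succ_sub h0 h1, fullStep, add_comm]
    rw [hstep, sum_Ico_succ_top (by omega), ← add_assoc, ih, restrict_add, restrict_sum, smul_add,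
      smul_sum, restrict_persistent_succ (show 0 ≤ t + 1 by omega), persistent_self, restrict_univ,
      restrict_smul, smul_smul]
    congr 2
    · rw [deltaProd_succ (show 1 ≤ t + 1 + 1 by omega),
        deltaProd_succ (show 2 ≤ (t + 2) + 1 by omega)]
      congr 1
      ring
    · refine sum_congr rfl fun k hk => ?_
      have := (mem_Ico.1 hk).2
      have e : deltaProd α (k + 1) (t + 2) = deltaProd α (k + 1) (t + 1) * delta α (t + 2) :=
        deltaProd_succ (by omega)
      rw [deltaProd_succ (show k + 1 ≤ (t + 2) + 1 by omega), restrict_smul, smul_smul,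
        restrict_persistent_succ (show k ≤ t + 1 by omega)]
      congr 1
      linear_combination
        (-2 * ((1 + α) / (1 - α)) * delta α (t + 3) * deltaProd α (k + 1) (t + 2)) * e
    · rw [deltaProd_of_lt (by omega), deltaProd_succ (show t + 2 + 1 ≤ (t + 2) + 1 by omega),
        deltaProd_of_lt (by omega), one_mul, one_mul]

lemma restrict_compl_fullStep (hdeg : ∀ v, 0 < G.degree v) (h0 : 0 < α) (h1 : α < 1) (hε0 : 0 < ε)
    (hε : ε ≤ 1 / (G.degree s : ℝ)) (t : ℕ) :
    restrict (active G α ε s (t + 1))ᶜ (fullStep G α ε s t) =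
      (deltaProd α 1 (t + 1) * deltaProd α 2 (t + 2)) •
          restrict (window G α ε s 0 (t + 1)) (res G α ε s 0) +
        ∑ k ∈ Ico 1 (t + 2), (2 * ((1 + α) / (1 - α)) *
          (deltaProd α (k + 1) (t + 1) * deltaProd α (k + 1) (t + 2))) •
          restrict (window G α ε s k (t + 1)) (res G α ε s k) := by
  simp only [fullStep_eq hdeg h0 h1 hε0 hε, restrict_add, restrict_sum, restrict_smul,
    restrict_compl_persistent]

lemma residual_sub (x y : V → ℝ) :
    residual G α s x - residual G α s y = -(matQ G α *ᵥ (x - y)) := by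
  simp only [residual, Matrix.mulVec_sub]
  abel

lemma res_sub (t t' : ℕ) : res G α ε s t - res G α ε s t' =
    -(matQ G α *ᵥ (iter G α ε s t - iter G α ε s t')) :=
  residual_sub _ _

lemma restrict_add_restrict_compl (S : Finset V) (v : V → ℝ) :
    restrict S v + restrict Sᶜ v = v := by
  ext u
  by_cases hu : u ∈ S <;> simp [restrict_apply, hu]

variable (G) in
lemma matQ_mulVec (x : V → ℝ) :
    matQ G α *ᵥ x = x - ((1 - α) / (1 + α)) • (normAdj G *ᵥ x) := by
  simp [matQ, Matrix.sub_mulVec, Matrix.smul_mulVec]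

lemma inv_contraction_mul (h0 : 0 < α) (h1 : α < 1) :
    (1 + α) / (1 - α) * ((1 - α) / (1 + α)) = 1 := by
  rw [← inv_div (1 - α)]
  exact inv_mul_cancel₀ (contraction_pos h0 h1).ne'

lemma res_one : res G α ε s 1 = ((1 - α) / (1 + α)) • (normAdj G *ᵥ res G α ε s 0) := by
  have h := res_sub (G := G) (α := α) (ε := ε) (s := s) 1 0
  rw [iter_one_sub, matQ_mulVec, neg_sub] at h
  exact (sub_left_inj.1 h)

/-- The full step would give the pure Chebyshev recurrence; the part of it that is not carried out
comes back through `Q`. -/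
lemma res_add_two (h0 : 0 < α) (h1 : α < 1) (t : ℕ) :
    res G α ε s (t + 2) = (2 * delta α (t + 2)) • (normAdj G *ᵥ res G α ε s (t + 1)) -
      (delta α (t + 1) * delta α (t + 2)) • res G α ε s t +
      matQ G α *ᵥ restrict (active G α ε s (t + 1))ᶜ (fullStep G α ε s t) := by
  have hsplit : restrict (active G α ε s (t + 1))ᶜ (fullStep G α ε s t) =
      fullStep G α ε s t - (iter G α ε s (t + 2) - iter G α ε s (t + 1)) := by
    rw [iter_succ_sub h0 h1, eq_sub_iff_add_eq', restrict_add_restrict_compl]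
  have h2 := res_sub (G := G) (α := α) (ε := ε) (s := s) (t + 2) (t + 1)
  have h3 := res_sub (G := G) (α := α) (ε := ε) (s := s) (t + 1) t
  rw [hsplit, Matrix.mulVec_sub, sub_eq_add_neg (matQ G α *ᵥ fullStep G α ε s t), ← h2, fullStep,
    Matrix.mulVec_add, Matrix.mulVec_smul, Matrix.mulVec_smul,
    show matQ G α *ᵥ (iter G α ε s (t + 1) - iter G α ε s t) =
      -(res G α ε s (t + 1) - res G α ε s t) by rw [h3, neg_neg], matQ_mulVec]
  ext u
  simp only [Pi.add_apply, Pi.sub_apply, Pi.smul_apply, Pi.neg_apply, smul_eq_mul]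
  linear_combination
    (2 * delta α (t + 2) * (normAdj G *ᵥ res G α ε s (t + 1)) u) * inv_contraction_mul h0 h1 +
    res G α ε s (t + 1) u * one_add_delta_mul_delta h0 h1 t

end Evolution

/-! ### Residual reduction rates and the Volterra inequality -/

section Rates

variable {V : Type*} [Fintype V] [DecidableEq V] {G : SimpleGraph V} [DecidableRel G.Adj]
  {α ε : ℝ} {s : V} {E : Matrix V V ℝ} {lam : V → ℝ}

lemma vecU_zero_apply {t : ℕ} (ht : 1 ≤ t) (i : V) :
    t * vecU G α ε s E lam 0 t i = ∑ j ∈ Ico 1 t, hEntry (t - j) (lam i) * (deltaProd α 2 j *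
      ((1 - (1 - α) / (1 + α) * lam i) *
        (Eᵀ *ᵥ restrict (window G α ε s 0 j) (res G α ε s 0)) i)) := by
  have ht' : (t : ℝ) ≠ 0 := by exact_mod_cast (by omega : t ≠ 0)
  rw [vecU, if_pos rfl, Finset.sum_apply, mul_sum]
  refine sum_congr rfl fun j _ => ?_
  rw [Pi.smul_apply, matH, Matrix.mulVec_diagonal, Matrix.sub_mulVec, Matrix.smul_mulVec,
    Pi.sub_apply, Pi.smul_apply, Matrix.one_mulVec, Matrix.mulVec_diagonal]
  simp only [smul_eq_mul]
  field_simp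

lemma vecU_apply {k t : ℕ} (hk : 1 ≤ k) (ht : k < t) (i : V) :
    ((t : ℝ) - k) * vecU G α ε s E lam k t i =
      ∑ j ∈ Ico k t, hEntry (t - j) (lam i) * (deltaProd α (k + 1) j *
      (((1 + α) / (1 - α) - lam i) *
        (Eᵀ *ᵥ restrict (window G α ε s k j) (res G α ε s k)) i)) := by
  have ht' : (t : ℝ) - k ≠ 0 := sub_ne_zero.2 (by exact_mod_cast ht.ne')
  rw [vecU, if_neg (by omega), Finset.sum_apply, mul_sum]
  refine sum_congr rfl fun j _ => ?_
  rw [Pi.smul_apply, matH, Matrix.mulVec_diagonal, Matrix.sub_mulVec, Matrix.smul_mulVec,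
    Pi.sub_apply, Pi.smul_apply, Matrix.one_mulVec, Matrix.mulVec_diagonal]
  simp only [smul_eq_mul]
  field_simp

lemma l2_matH_mulVec_le (hlam : ∀ i, |lam i| ≤ 1) (j t : ℕ) (v : V → ℝ) :
    l2 (matH lam j t *ᵥ v) ≤ (t - j : ℕ) * l2 v :=
  l2_diagonal_mulVec_le (Nat.cast_nonneg _) (fun i => abs_hEntry_le (hlam i) _) v

lemma sum_pow_sub_le {q : ℝ} (h0 : 0 ≤ q) (h1 : q < 1) (k t : ℕ) :
    ∑ j ∈ Ico k t, q ^ (j - k) ≤ (1 - q)⁻¹ := by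
  rw [sum_Ico_eq_sum_range]
  simp only [Nat.add_sub_cancel_left]
  rw [← tsum_geometric_of_lt_one h0 h1]
  exact (summable_geometric_of_lt_one h0 h1).sum_le_tsum _ fun _ _ => by positivity

/-- A bound, uniform in `t`, for sums of the form of `u_{k,t}`. -/
lemma l2_sum_matH_le (h0 : 0 < α) (h1 : α < 1) (hE : E * Eᵀ = 1) (hlam : ∀ i, |lam i| ≤ 1)
    {m k t : ℕ} (hm : 1 ≤ m) {d M : ℝ} (hd0 : 0 ≤ d) (hd : ∀ j, m ≤ j → ((t - j : ℕ) : ℝ) ≤ d)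
    {B : Matrix V V ℝ} (hM : 0 ≤ M) (hB : ∀ v, l2 (B *ᵥ v) ≤ M * l2 v) :
    l2 (∑ j ∈ Ico m t, (deltaProd α (m + 1) j / d) • (matH lam j t *ᵥ (B *ᵥ
      (Eᵀ *ᵥ restrict (window G α ε s k j) (res G α ε s k))))) ≤
      (1 - (1 - α) / (1 + α))⁻¹ * M * l2 (res G α ε s k) := by
  have hq0 := (contraction_pos h0 h1).le
  have hq1 := contraction_lt_one h0
  set q := (1 - α) / (1 + α)
  have hterm : ∀ j ∈ Ico m t, l2 ((deltaProd α (m + 1) j / d) • (matH lam j t *ᵥ (B *ᵥ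
      (Eᵀ *ᵥ restrict (window G α ε s k j) (res G α ε s k))))) ≤
      q ^ (j - m) * (M * l2 (res G α ε s k)) := by
    intro j hj
    have hj := (mem_Ico.1 hj).1
    have hδ := deltaProd_le h0 h1 (show 1 ≤ m + 1 by omega) j
    have hδ0 := deltaProd_pos h0 h1 (show 1 ≤ m + 1 by omega) j
    rw [Nat.add_sub_add_right] at hδ
    have hv : l2 (B *ᵥ (Eᵀ *ᵥ restrict (window G α ε s k j) (res G α ε s k))) ≤
        M * l2 (res G α ε s k) := by
      refine (hB _).trans (mul_le_mul_of_nonneg_left ?_ hM)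
      rw [l2_transpose_mulVec hE]
      exact l2_restrict_le _ _
    rw [l2_smul, abs_of_nonneg (by positivity)]
    have hH := (l2_matH_mulVec_le hlam j t _).trans (mul_le_mul (hd j hj) hv (l2_nonneg _) hd0)
    have hr := mul_nonneg hM (l2_nonneg (res G α ε s k))
    calc _ ≤ deltaProd α (m + 1) j / d * (d * (M * l2 (res G α ε s k))) := by gcongr
      _ = deltaProd α (m + 1) j * (d / d) * (M * l2 (res G α ε s k)) := by ring
      _ ≤ deltaProd α (m + 1) j * 1 * (M * l2 (res G α ε s k)) := by
        gcongr
        -- This includes `d = 0`, where `d / d = 0`.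
        exact div_self_le_one d
      _ ≤ _ := by rw [mul_one]; gcongr
  refine (l2_sum_le _ _).trans ((sum_le_sum hterm).trans ?_)
  rw [← sum_mul, mul_assoc]
  exact mul_le_mul_of_nonneg_right (sum_pow_sub_le hq0 hq1 m t)
    (mul_nonneg hM (l2_nonneg _))

lemma l2_smul_one_sub_diagonal_le (hlam : ∀ i, |lam i| ≤ 1) (a c : ℝ) (v : V → ℝ) :
    l2 ((a • (1 : Matrix V V ℝ) - c • Matrix.diagonal lam) *ᵥ v) ≤ (|a| + |c|) * l2 v := by
  have h : a • (1 : Matrix V V ℝ) - c • Matrix.diagonal lam =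
      Matrix.diagonal fun i => a - c * lam i := by
    ext i j
    rcases eq_or_ne i j with rfl | hij <;> simp [*]
  rw [h]
  refine l2_diagonal_mulVec_le (by positivity) (fun i => (abs_sub _ _).trans ?_) v
  rw [abs_mul]
  have := mul_le_mul_of_nonneg_left (hlam i) (abs_nonneg c)
  linarith

/-- The entries of `H_{j,t}` are at most `t - j`, which the denominators absorb, and the products of
the `δ_i` decay geometrically. Uniformity in `t` makes the suprema `β_k` genuine: an unbounded real
supremum would be `0` by convention. In `l2_sum_matH_le`, `m` is the first summation index: `1` if
`k = 0`, and `k` otherwise. -/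
lemma exists_l2_vecU_le (h0 : 0 < α) (h1 : α < 1) (hE : E * Eᵀ = 1) (hlam : ∀ i, |lam i| ≤ 1) :
    ∃ M, 0 ≤ M ∧ ∀ k t, l2 (vecU G α ε s E lam k t) ≤ M * l2 (res G α ε s k) := by
  have hq := sub_pos.2 (contraction_lt_one h0)
  set K := max (|(1 : ℝ)| + |(1 - α) / (1 + α)|) (|(1 + α) / (1 - α)| + |(1 : ℝ)|) with hK
  have hK0 : 0 ≤ K := le_max_of_le_left (by positivity)
  refine ⟨(1 - (1 - α) / (1 + α))⁻¹ * K, by positivity, fun k t => ?_⟩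
  rw [vecU]
  split_ifs with hk
  · subst hk
    refine l2_sum_matH_le h0 h1 hE hlam le_rfl (Nat.cast_nonneg t)
      (fun j _ => by exact_mod_cast Nat.sub_le t j) hK0 fun v => ?_
    have := l2_smul_one_sub_diagonal_le hlam 1 ((1 - α) / (1 + α)) v
    rw [one_smul] at this
    exact this.trans (mul_le_mul_of_nonneg_right (le_max_left _ _) (l2_nonneg v))
  · rcases le_or_gt t k with ht | ht
    · rw [Ico_eq_empty_of_le ht, sum_empty, l2_zero]
      exact mul_nonneg (by positivity) (l2_nonneg _)
    · refine l2_sum_matH_le h0 h1 hE hlam (Nat.one_le_iff_ne_zero.2 hk)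
        (sub_nonneg.2 (by exact_mod_cast ht.le)) (fun j hj => ?_) hK0 fun v => ?_
      · rw [← Nat.cast_sub ht.le]
        exact_mod_cast Nat.sub_le_sub_left hj t
      · have := l2_smul_one_sub_diagonal_le hlam ((1 + α) / (1 - α)) 1 v
        rw [one_smul] at this
        exact this.trans (mul_le_mul_of_nonneg_right (le_max_right _ _) (l2_nonneg v))

lemma bddAbove_betaAt (h0 : 0 < α) (h1 : α < 1) (hE : E * Eᵀ = 1) (hlam : ∀ i, |lam i| ≤ 1)
    (k : ℕ) : BddAbove (Set.range fun t : ℕ => betaAt G α ε s E lam k t) := by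
  obtain ⟨M, hM, h⟩ := exists_l2_vecU_le (G := G) (ε := ε) (s := s) h0 h1 hE hlam
  refine ⟨M, ?_⟩
  rintro _ ⟨t, rfl⟩
  exact div_le_of_le_mul₀ (l2_nonneg _) hM (h k t)

lemma beta_nonneg (N : ℕ∞) (k : ℕ) : 0 ≤ beta G α ε s E lam N k :=
  Real.iSup_nonneg fun _ => div_nonneg (l2_nonneg _) (l2_nonneg _)

lemma l2_vecU_le (h0 : 0 < α) (h1 : α < 1) (hE : E * Eᵀ = 1) (hlam : ∀ i, |lam i| ≤ 1) {N : ℕ∞}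
    {k t : ℕ} (hk : k < t) (ht : (t : ℕ∞) ≤ N) :
    l2 (vecU G α ε s E lam k t) ≤ beta G α ε s E lam N k * l2 (res G α ε s k) := by
  have hle : betaAt G α ε s E lam k t ≤ beta G α ε s E lam N k := by
    refine le_ciSup (f := fun t : {t : ℕ // k < t ∧ (t : ℕ∞) ≤ N} => betaAt G α ε s E lam k t.1)
      ((bddAbove_betaAt (G := G) (ε := ε) (s := s) h0 h1 hE hlam k).mono ?_) ⟨t, hk, ht⟩
    rintro _ ⟨t, rfl⟩
    exact ⟨t.1, rfl⟩
  rcases (l2_nonneg (res G α ε s k)).eq_or_lt with hr | hr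
  -- If `r^(k) = 0`, the quotient carries no information, but the uniform bound forces `u_{k,t} =
  -- 0`.
  · obtain ⟨M, -, h⟩ := exists_l2_vecU_le (G := G) (ε := ε) (s := s) h0 h1 hE hlam
    simpa [← hr] using h k t
  · rwa [betaAt, div_le_iff₀ hr] at hle

/-- The residual in the eigenbasis, scaled by `δ_{1:t}`. -/
lemma scaled_residual_eq (hdeg : ∀ v, 0 < G.degree v) (h : IsEigendecomposition G E lam)
    (h0 : 0 < α) (h1 : α < 1) (hε0 : 0 < ε) (hε : ε ≤ 1 / (G.degree s : ℝ)) {t : ℕ} (ht : 1 ≤ t) :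
    (deltaProd α 1 t)⁻¹ • (Eᵀ *ᵥ res G α ε s t) =
      Matrix.diagonal (fun i => Real.cos (t * Real.arccos (lam i))) *ᵥ (Eᵀ *ᵥ res G α ε s 0) +
        (t : ℝ) • vecU G α ε s E lam 0 t +
        ∑ k ∈ Ico 1 t, (2 * ((t : ℝ) - k) * (deltaProd α 1 k)⁻¹) • vecU G α ε s E lam k t := by
  ext i
  have hl := h.abs_le_one hdeg i
  have hE : ∀ v : V → ℝ, (Eᵀ *ᵥ (matQ G α *ᵥ v)) i =
      (1 - (1 - α) / (1 + α) * lam i) * (Eᵀ *ᵥ v) i := fun v => by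
    rw [matQ_mulVec, Matrix.mulVec_sub, Matrix.mulVec_smul, Pi.sub_apply, Pi.smul_apply,
      h.mulVec_transpose, smul_eq_mul]
    ring
  have hP : ∀ k, deltaProd α 1 k ≠ 0 := fun k => (deltaProd_pos h0 h1 le_rfl k).ne'
  set c : ℕ → ℕ → ℝ := fun k j =>
    (Eᵀ *ᵥ restrict (window G α ε s k j) (res G α ε s k)) i with hc
  set w : ℕ → ℝ := fun t => (deltaProd α 1 t)⁻¹ * (Eᵀ *ᵥ res G α ε s t) i with hw
  -- The forcing divided by `δ_{1:j+1} = δ_{1:k} δ_{k+1:j+1}`, which leaves `δ_{1:k}⁻¹`. The factor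
  -- `(1+α)/(1-α) - λ` is `(1+α)/(1-α)` times the eigenvalue of `Q`.
  set F : ℕ → ℝ := fun j =>
    deltaProd α 2 j * ((1 - (1 - α) / (1 + α) * lam i) * c 0 j) +
      ∑ k ∈ Ico 1 (j + 1), 2 * (deltaProd α 1 k)⁻¹ * (deltaProd α (k + 1) j *
        (((1 + α) / (1 - α) - lam i) * c k j)) with hF
  have hw0 : w 0 = (Eᵀ *ᵥ res G α ε s 0) i := by simp [hw, deltaProd]
  have hw1 : w 1 = lam i * w 0 := by
    rw [hw0]
    simp only [hw]
    rw [res_one, Matrix.mulVec_smul, Pi.smul_apply, h.mulVec_transpose, smul_eq_mul, deltaProd,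
      Icc_self, prod_singleton, delta, inv_mul_cancel_left₀ (contraction_pos h0 h1).ne']
  have hrec : ∀ t, w (t + 2) = 2 * lam i * w (t + 1) - w t + F (t + 1) := by
    intro t
    have hP1 : deltaProd α 1 (t + 1) = deltaProd α 1 t * delta α (t + 1) :=
      deltaProd_succ (by omega)
    have hP2 : deltaProd α 1 (t + 2) = deltaProd α 1 t * delta α (t + 1) * delta α (t + 2) := by
      rw [← hP1]; exact deltaProd_succ (by omega)
    have hforce : (Eᵀ *ᵥ (matQ G α *ᵥ restrict (active G α ε s (t + 1))ᶜ
        (fullStep G α ε s t))) i = deltaProd α 1 (t + 2) * F (t + 1) := by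
      rw [hE, restrict_compl_fullStep hdeg h0 h1 hε0 hε, Matrix.mulVec_add, Matrix.mulVec_sum,
        Pi.add_apply, Finset.sum_apply, Matrix.mulVec_smul, Pi.smul_apply, smul_eq_mul]
      simp only [Matrix.mulVec_smul, Pi.smul_apply, smul_eq_mul, hF, mul_add, mul_sum]
      congr 1
      · have e : deltaProd α 2 (t + 2) = deltaProd α 2 (t + 1) * delta α (t + 2) :=
          deltaProd_succ (by omega)
        rw [e, hP2, hP1]
        ring
      · refine sum_congr rfl fun k hk => ?_
        rw [← deltaProd_mul_deltaProd α (show k ≤ t + 2 by have := (mem_Ico.1 hk).2; omega)]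
        have hPk := mul_inv_cancel₀ (hP k)
        linear_combination (-2 * deltaProd α (k + 1) (t + 1) * deltaProd α (k + 1) (t + 2) *
          lam i * c k (t + 1)) * inv_contraction_mul h0 h1 -
          (2 * deltaProd α (k + 1) (t + 1) * deltaProd α (k + 1) (t + 2) *
          ((1 + α) / (1 - α) - lam i) * c k (t + 1)) * hPk
    have hd1 := (delta_pos h0 h1 t).ne'
    have hd2 := (delta_pos h0 h1 (t + 1)).ne'
    have hPt := hP t
    simp only [hw]
    rw [res_add_two h0 h1, Matrix.mulVec_add, Matrix.mulVec_sub, Matrix.mulVec_smul,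
      Matrix.mulVec_smul, Pi.add_apply, Pi.sub_apply, Pi.smul_apply, Pi.smul_apply, hforce,
      h.mulVec_transpose, mul_add, inv_mul_cancel_left₀ (hP _), hP2, hP1]
    simp only [smul_eq_mul]
    field_simp
  have hsol := chebyshev_variation_of_constants hl hw1 hrec t
  rw [hw0] at hsol
  rw [Pi.smul_apply, smul_eq_mul, Pi.add_apply, Pi.add_apply, Matrix.mulVec_diagonal,
    Pi.smul_apply, smul_eq_mul, vecU_zero_apply ht, Finset.sum_apply]
  refine hsol.trans ?_
  rw [add_assoc]
  congr 1
  simp only [hF, mul_add, sum_add_distrib, mul_sum]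
  congr 1
  -- With `k` fixed, the sum over `j` is the one that defines `u_{k,t}`.
  rw [← sum_Ico_Ico_comm]
  refine sum_congr rfl fun k hk => ?_
  obtain ⟨hk1, hkt⟩ := mem_Ico.1 hk
  rw [Pi.smul_apply, smul_eq_mul, show 2 * ((t : ℝ) - k) * (deltaProd α 1 k)⁻¹ *
    vecU G α ε s E lam k t i = 2 * (deltaProd α 1 k)⁻¹ * (((t : ℝ) - k) *
    vecU G α ε s E lam k t i) by ring, vecU_apply hk1 hkt, mul_sum]
  refine sum_congr rfl fun j _ => ?_
  ring

lemma l2_res_div_le (hdeg : ∀ v, 0 < G.degree v) (h : IsEigendecomposition G E lam)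
    (h0 : 0 < α) (h1 : α < 1) (hε0 : 0 < ε) (hε : ε ≤ 1 / (G.degree s : ℝ)) {N : ℕ∞} {t : ℕ}
    (ht : 1 ≤ t) (htN : (t : ℕ∞) ≤ N) :
    l2 (res G α ε s t) / deltaProd α 1 t ≤
      l2 (res G α ε s 0) * (1 + t * beta G α ε s E lam N 0) +
        2 * ∑ k ∈ Ico 1 t, ((t : ℝ) - k) * beta G α ε s E lam N k *
          (l2 (res G α ε s k) / deltaProd α 1 k) := by
  have hlam := h.abs_le_one hdeg
  have hP := fun k => deltaProd_pos h0 h1 le_rfl k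
  have e1 : l2 (res G α ε s t) / deltaProd α 1 t =
      l2 ((deltaProd α 1 t)⁻¹ • (Eᵀ *ᵥ res G α ε s t)) := by
    rw [l2_smul, l2_transpose_mulVec h.1, abs_of_pos (inv_pos.2 (hP t)), div_eq_inv_mul]
  rw [e1, scaled_residual_eq hdeg h h0 h1 hε0 hε ht]
  refine (l2_add_le _ _).trans (add_le_add ((l2_add_le _ _).trans ?_) ?_)
  · rw [mul_add, mul_one]
    refine add_le_add ?_ ?_
    · have := l2_diagonal_mulVec_le zero_le_one
        (fun i => Real.abs_cos_le_one (t * Real.arccos (lam i))) (Eᵀ *ᵥ res G α ε s 0)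
      rwa [one_mul, l2_transpose_mulVec h.1] at this
    · rw [l2_smul, Nat.abs_cast]
      have := mul_le_mul_of_nonneg_left (l2_vecU_le (G := G) (ε := ε) (s := s) h0 h1 h.1 hlam
        (show 0 < t by omega) htN) (Nat.cast_nonneg (α := ℝ) t)
      linarith
  · rw [mul_sum]
    refine (l2_sum_le _ _).trans (sum_le_sum fun k hk => ?_)
    have hk := (mem_Ico.1 hk).2
    have hkt : (0 : ℝ) ≤ (t : ℝ) - k := sub_nonneg.2 (by exact_mod_cast hk.le)
    have hPk := hP k
    rw [l2_smul, abs_of_nonneg (by positivity)]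
    refine (mul_le_mul_of_nonneg_left (l2_vecU_le (G := G) (ε := ε) (s := s) h0 h1 h.1 hlam hk htN)
      (by positivity)).trans_eq ?_
    ring

end Rates

/-! ### Comparison with the solution of the Volterra equation -/

section Majorant

variable {β : ℕ → ℝ} {c : ℝ}

/-- The increments do not decrease, since `y_t` is divided by a number at least `1`; this uses `y_t
> 0`, so both claims go through one induction. -/
lemma ySeq_pos_and_le_succ (hβ : ∀ k, 0 ≤ β k) (hc : 0 < c) (t : ℕ) :
    0 < ySeq β c t ∧ ySeq β c t ≤ ySeq β c (t + 1) := by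
  induction t with
  | zero => exact ⟨hc, le_rfl⟩
  | succ t ih =>
    refine ⟨ih.1.trans_le ih.2, ?_⟩
    have hb : 1 ≤ (1 + β t) * (1 + β (t + 1)) :=
      one_le_mul_of_one_le_of_one_le (by linarith [hβ t]) (by linarith [hβ (t + 1)])
    have h := div_le_self ih.1.le hb
    show _ ≤ 2 * ySeq β c (t + 1) - ySeq β c t / ((1 + β t) * (1 + β (t + 1)))
    linarith [ih.2]

lemma ySeq_pos (hβ : ∀ k, 0 ≤ β k) (hc : 0 < c) (t : ℕ) : 0 < ySeq β c t :=
  (ySeq_pos_and_le_succ hβ hc t).1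

lemma ySeq_monotone (hβ : ∀ k, 0 ≤ β k) (hc : 0 < c) : Monotone (ySeq β c) :=
  monotone_nat_of_le_succ fun t => (ySeq_pos_and_le_succ hβ hc t).2

variable (β c) in
/-- The scaled sequence `∏_{j<t} (1+β_j) y_t`, which solves `Y_{t+1} = 2 (1+β_t) Y_t - Y_{t-1}`. -/
noncomputable def majorant (t : ℕ) : ℝ := (∏ j ∈ range t, (1 + β j)) * ySeq β c t

lemma majorant_add_two (hβ : ∀ k, 0 ≤ β k) (t : ℕ) :
    majorant β c (t + 2) = 2 * (1 + β (t + 1)) * majorant β c (t + 1) - majorant β c t := by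
  have e0 : 1 + β t ≠ 0 := by linarith [hβ t]
  have e1 : 1 + β (t + 1) ≠ 0 := by linarith [hβ (t + 1)]
  rw [majorant, majorant, majorant, ySeq, prod_range_succ, prod_range_succ]
  field_simp

/-- The second difference of `Y` is `2 β_{t+1} Y_{t+1}`, and `Y_1 - Y_0 = c β_0`. This is the first
summation; a second one yields `majorant_eq`. -/
lemma majorant_succ_sub (hβ : ∀ k, 0 ≤ β k) (t : ℕ) :
    majorant β c (t + 1) - majorant β c t =
      c * β 0 + 2 * ∑ k ∈ Ico 1 (t + 1), β k * majorant β c k := by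
  induction t with
  | zero => simp [majorant, ySeq]; ring
  | succ t ih =>
    rw [majorant_add_two hβ, sum_Ico_succ_top (by omega)]
    linear_combination ih

lemma majorant_eq (hβ : ∀ k, 0 ≤ β k) (t : ℕ) :
    majorant β c t = c * (1 + t * β 0) +
      2 * ∑ k ∈ Ico 1 t, ((t : ℝ) - k) * β k * majorant β c k := by
  induction t with
  | zero => simp [majorant, ySeq]
  | succ t ih =>
    have e : ∑ k ∈ Ico 1 (t + 1), (((t + 1 : ℕ) : ℝ) - k) * β k * majorant β c k =
        ∑ k ∈ Ico 1 t, ((t : ℝ) - k) * β k * majorant β c k +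
          ∑ k ∈ Ico 1 (t + 1), β k * majorant β c k := by
      have e0 : ∑ k ∈ Ico 1 t, ((t : ℝ) - k) * β k * majorant β c k =
          ∑ k ∈ Ico 1 (t + 1), ((t : ℝ) - k) * β k * majorant β c k := by
        rcases t with _ | t
        · simp
        · rw [sum_Ico_succ_top (by omega : 1 ≤ t + 1)]; simp
      rw [e0, ← sum_add_distrib]
      refine sum_congr rfl fun k _ => ?_
      push_cast
      ring
    rw [e]
    push_cast
    linear_combination ih + majorant_succ_sub (c := c) hβ t

/-- Comparison of a sequence that satisfies a linear Volterra inequality with the majorant. -/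
lemma le_majorant (hβ : ∀ k, 0 ≤ β k) {N : ℕ∞} {a : ℕ → ℝ} (h0 : a 0 = c)
    (h : ∀ t : ℕ, 1 ≤ t → (t : ℕ∞) ≤ N →
      a t ≤ c * (1 + t * β 0) + 2 * ∑ k ∈ Ico 1 t, ((t : ℝ) - k) * β k * a k)
    (t : ℕ) (ht : (t : ℕ∞) ≤ N) : a t ≤ majorant β c t := by
  induction t using Nat.strong_induction_on with
  | _ t ih =>
    rcases Nat.eq_zero_or_pos t with rfl | hpos
    · simp [majorant, ySeq, h0]
    · refine (h t hpos ht).trans ?_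
      rw [majorant_eq hβ t]
      -- The weights are nonnegative, so the induction hypothesis can be inserted termwise.
      gcongr with k hk
      · have hkt := (mem_Ico.1 hk).2
        exact mul_nonneg (sub_nonneg.2 (by exact_mod_cast hkt.le)) (hβ k)
      · have hkt := (mem_Ico.1 hk).2
        exact ih k hkt (le_trans (by exact_mod_cast hkt.le) ht)

end Majorant

/-! ### The residual bound -/

section ResidualBound

variable {V : Type*} [Fintype V] [DecidableEq V] {G : SimpleGraph V} [DecidableRel G.Adj]
  {α ε : ℝ} {s : V} {E : Matrix V V ℝ} {lam : V → ℝ}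

variable (G α ε s) in
lemma l2_res_zero : l2 (res G α ε s 0) = |2 * α / (1 + α) * (√(G.degree s))⁻¹| := by
  rw [res_zero, l2_eq_sqrt, ← Real.sqrt_sq_eq_abs]
  congr 1
  rw [sum_eq_single s (fun u _ hu => by simp [hu]) (by simp)]
  simp

lemma l2_res_zero_pos (hdeg : ∀ v, 0 < G.degree v) (h0 : 0 < α) : 0 < l2 (res G α ε s 0) := by
  have : 0 < √(G.degree s : ℝ) := Real.sqrt_pos.2 (by exact_mod_cast hdeg s)
  rw [l2_res_zero]
  positivity

lemma l2_res_le (hdeg : ∀ v, 0 < G.degree v) (h : IsEigendecomposition G E lam)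
    (h0 : 0 < α) (h1 : α < 1) (hε0 : 0 < ε) (hε : ε ≤ 1 / (G.degree s : ℝ)) {N : ℕ∞} {t : ℕ}
    (htN : (t : ℕ∞) ≤ N) :
    l2 (res G α ε s t) ≤ deltaProd α 1 t *
      (∏ j ∈ range t, (1 + beta G α ε s E lam N j)) *
        ySeq (beta G α ε s E lam N) (l2 (res G α ε s 0)) t := by
  have := le_majorant (a := fun t => l2 (res G α ε s t) / deltaProd α 1 t)
    (c := l2 (res G α ε s 0)) (beta_nonneg (G := G) (α := α) (ε := ε) (s := s) (E := E)
      (lam := lam) N) (by simp [deltaProd])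
    (fun t ht htN => l2_res_div_le hdeg h h0 h1 hε0 hε ht htN) t htN
  rw [div_le_iff₀' (deltaProd_pos h0 h1 le_rfl t), majorant, ← mul_assoc] at this
  exact this

end ResidualBound

/-! ### Bounds on the number of iterations and the runtime -/

section Runtime

variable {V : Type*} [Fintype V] [DecidableEq V] {G : SimpleGraph V} [DecidableRel G.Adj]
  {α ε : ℝ} {s : V} {E : Matrix V V ℝ} {lam : V → ℝ} {T : ℕ}

lemma active_nonempty_of_isLeast (hT : IsLeast {t : ℕ | active G α ε s t = ∅} T) {t : ℕ}
    (ht : t < T) : (active G α ε s t).Nonempty :=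
  nonempty_iff_ne_empty.2 fun h => absurd (hT.2 h) (not_le.2 ht)

lemma pos_of_isLeast (hdeg : ∀ v, 0 < G.degree v) (h0 : 0 < α) (hε0 : 0 < ε)
    (hε : ε ≤ 1 / (G.degree s : ℝ)) (hT : IsLeast {t : ℕ | active G α ε s t = ∅} T) : 0 < T := by
  refine Nat.pos_of_ne_zero fun h => ?_
  have := hT.1
  rw [h, Set.mem_ofPred_eq, active_zero hdeg h0 hε0 hε] at this
  exact singleton_ne_empty s this

lemma runtime_eq_mul_avgVol (hT : T ≠ 0) :
    runtime G α ε s T = T * avgVol G α ε s T := by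
  have : (T : ℝ) ≠ 0 := by exact_mod_cast hT
  rw [runtime, avgVol]
  field_simp

/-- The additive constant of the iteration bound is the logarithm of this number. -/
noncomputable def excess (α : ℝ) : ℝ := (1 + α) * (1 + √α) / (2 * α * (1 - √α))

lemma sqrt_lt_one_of_lt_one {α : ℝ} (h1 : α < 1) : √α < 1 := by
  rw [Real.sqrt_lt' one_pos]; simpa using h1

lemma excess_pos (h0 : 0 < α) (h1 : α < 1) : 0 < excess α := by
  have hs0 : 0 < √α := Real.sqrt_pos.2 h0
  have hs1 := sub_pos.2 (sqrt_lt_one_of_lt_one h1)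
  unfold excess
  positivity

lemma iterations_le (hdeg : ∀ v, 0 < G.degree v) (h : IsEigendecomposition G E lam)
    (h0 : 0 < α) (h1 : α < 1) (hε0 : 0 < ε) (hε : ε ≤ 1 / (G.degree s : ℝ))
    (hT : IsLeast {t : ℕ | active G α ε s t = ∅} T) {N : ℕ∞} (hTN : (T : ℕ∞) ≤ N) {c : ℝ}
    (hc0 : 0 ≤ c) (hc2 : c < 2)
    (hgeom : geomMean (beta G α ε s E lam N) T = 1 + c * √α / (1 - √α)) :
    (T : ℝ) ≤ (1 + √α) / (√α * (2 - c)) *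
      (Real.log (2 * ySeq (beta G α ε s E lam N) (l2 (res G α ε s 0)) T / ε) +
        Real.log (excess α)) := by
  have hs0 : 0 < √α := Real.sqrt_pos.2 h0
  have hs1 := sub_pos.2 (sqrt_lt_one_of_lt_one h1)
  have hTpos := pos_of_isLeast hdeg h0 hε0 hε hT
  -- Time `n = T - 1` is the last one with an active node.
  obtain ⟨n, rfl⟩ : ∃ n, T = n + 1 := ⟨T - 1, by omega⟩
  have hβ := beta_nonneg (G := G) (α := α) (ε := ε) (s := s) (E := E) (lam := lam) N
  have hr0 := l2_res_zero_pos (ε := ε) (s := s) hdeg h0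
  set β := beta G α ε s E lam N
  have hy := ySeq_pos hβ hr0 (n + 1)
  set y := ySeq β (l2 (res G α ε s 0)) (n + 1) with hydef
  set ρ := (1 - √α) / (1 + √α) with hρ
  have hρ0 : 0 < ρ := div_pos hs1 (by linarith)
  set γ := 1 + c * √α / (1 - √α) with hγ
  set a := (2 - c) * √α / (1 + √α) with ha
  clear_value ρ γ a
  have ha0 : 0 < a := ha ▸ div_pos (mul_pos (by linarith) hs0) (by linarith)
  have hργ : ρ * γ = 1 - a := by
    have hne := hs1.ne'
    rw [hρ, hγ, ha]
    field_simp
    ring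
  have hγ0 : 0 < γ := by rw [hγ]; positivity
  have hprod : ∏ j ∈ range (n + 1), (1 + β j) = γ ^ (n + 1) := by
    rw [← hgeom, geomMean, one_div, Real.rpow_inv_natCast_pow _ n.succ_ne_zero]
    exact prod_nonneg fun j _ => by linarith [hβ j]
  obtain ⟨u, hu⟩ := active_nonempty_of_isLeast hT n.lt_succ_self
  have hd1 : 1 ≤ √(G.degree u : ℝ) := Real.one_le_sqrt.2 (by exact_mod_cast hdeg u)
  have hlow : 2 * α * ε / (1 + α) ≤ l2 (res G α ε s n) := by
    refine le_trans ?_ ((mem_active.1 hu).trans (abs_apply_le_l2 _ u))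
    exact div_le_div_of_nonneg_right (le_mul_of_one_le_right (by positivity) hd1) (by linarith)
  -- Passing from `n` to `n + 1` is free for the product and for `y`, which are monotone, but not
  -- for `ρ`: the missing factor `ρ` ends up in `excess`.
  have hup : l2 (res G α ε s n) ≤ 2 * ρ ^ n * γ ^ (n + 1) * y := by
    refine (l2_res_le hdeg h h0 h1 hε0 hε
      (le_trans (by exact_mod_cast n.le_succ) hTN)).trans ?_
    have hP : ∏ j ∈ range n, (1 + β j) ≤ γ ^ (n + 1) := by
      rw [← hprod, prod_range_succ]
      exact le_mul_of_one_le_right (prod_nonneg fun j _ => by linarith [hβ j])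
        (by linarith [hβ n])
    have hP0 : 0 ≤ ∏ j ∈ range n, (1 + β j) := prod_nonneg fun j _ => by linarith [hβ j]
    refine mul_le_mul (mul_le_mul (hρ ▸ deltaProd_one_le h0 h1 n) hP hP0 (by positivity))
      (ySeq_monotone hβ hr0 n.le_succ) (ySeq_pos hβ hr0 n).le (by positivity)
  have hexp : (ρ * γ) ^ (n + 1) ≤ Real.exp (-(a * (n + 1 : ℕ))) := by
    have h1a : ρ * γ ≤ Real.exp (-a) := by
      rw [hργ]; linarith [Real.add_one_le_exp (-a)]
    refine (pow_le_pow_left₀ (by positivity) h1a _).trans_eq ?_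
    rw [← Real.exp_nat_mul, mul_neg, mul_comm]
  have hmain : 2 * α * ε / (1 + α) * ρ ≤ 2 * y * Real.exp (-(a * (n + 1 : ℕ))) := by
    calc 2 * α * ε / (1 + α) * ρ ≤ 2 * ρ ^ n * γ ^ (n + 1) * y * ρ := by
          gcongr; exact hlow.trans hup
      _ = 2 * y * (ρ * γ) ^ (n + 1) := by ring
      _ ≤ _ := by gcongr
  have hfinal : Real.exp (a * (n + 1 : ℕ)) ≤ 2 * y / ε * excess α := by
    rw [Real.exp_neg, ← div_eq_mul_inv, le_div_iff₀ (Real.exp_pos _)] at hmain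
    rw [excess, div_mul_div_comm, le_div_iff₀ (by positivity)]
    rw [hρ] at hmain
    have e : 2 * α * ε / (1 + α) * ((1 - √α) / (1 + √α)) =
        2 * α * ε * (1 - √α) / ((1 + α) * (1 + √α)) := by rw [div_mul_div_comm]
    rw [e, div_mul_eq_mul_div, div_le_iff₀ (by positivity)] at hmain
    linarith
  have hlog := (Real.le_log_iff_exp_le
    (mul_pos (div_pos (mul_pos two_pos hy) hε0) (excess_pos h0 h1))).2 hfinal
  rw [Real.log_mul (by positivity) (excess_pos h0 h1).ne'] at hlog
  have hinv : (1 + √α) / (√α * (2 - c)) * a = 1 := by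
    have : 2 - c ≠ 0 := by linarith
    rw [ha]
    field_simp
  have hco : 0 ≤ (1 + √α) / (√α * (2 - c)) := by
    have : 0 < 2 - c := by linarith
    positivity
  calc ((n + 1 : ℕ) : ℝ) = (1 + √α) / (√α * (2 - c)) * (a * (n + 1 : ℕ)) := by
        rw [← mul_assoc, hinv, one_mul]
    _ ≤ _ := mul_le_mul_of_nonneg_left hlog hco

/-- Below this tolerance the logarithm in the iteration bound dominates the additive constant. -/
noncomputable def tolerance (α : ℝ) : ℝ := (4 * α / ((1 + α) * excess α)) ^ 2

lemma tolerance_pos (h0 : 0 < α) (h1 : α < 1) : 0 < tolerance α := by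
  have := excess_pos h0 h1
  unfold tolerance
  positivity

/-- Since `d_s ≤ 1/ε`, `y_t ≥ ‖r^(0)‖ ≥ 2α√ε/(1+α)`, hence `2 y_t/ε ≥ 4α/((1+α)√ε)`, independently
of the graph. `tolerance` is the `ε` at which this lower bound equals `excess`. -/
lemma log_excess_le (hdeg : ∀ v, 0 < G.degree v) (h0 : 0 < α) (h1 : α < 1) (hε0 : 0 < ε)
    (hε : ε ≤ 1 / (G.degree s : ℝ)) (hεt : ε ≤ tolerance α) {β : ℕ → ℝ} (hβ : ∀ k, 0 ≤ β k)
    (t : ℕ) :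
    Real.log (excess α) ≤ Real.log (2 * ySeq β (l2 (res G α ε s 0)) t / ε) := by
  have hr0 := l2_res_zero_pos (ε := ε) (s := s) hdeg h0
  have hex := excess_pos h0 h1
  have hy : l2 (res G α ε s 0) ≤ ySeq β (l2 (res G α ε s 0)) t :=
    ySeq_monotone hβ hr0 (Nat.zero_le t)
  have hd : (0 : ℝ) < G.degree s := by exact_mod_cast hdeg s
  have hr : 2 * α / (1 + α) * √ε ≤ l2 (res G α ε s 0) := by
    rw [l2_res_zero]
    refine le_trans ?_ (le_abs_self _)
    gcongr
    rw [← Real.sqrt_inv, ← one_div]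
    exact Real.sqrt_le_sqrt hε
  have hsε : √ε ≤ 4 * α / ((1 + α) * excess α) :=
    (Real.sqrt_le_left (by positivity)).2 hεt
  have hsq : √ε * √ε = ε := Real.mul_self_sqrt hε0.le
  refine Real.log_le_log hex ?_
  rw [le_div_iff₀ hε0]
  rw [le_div_iff₀ (by positivity)] at hsε
  have h3 : 2 * α / (1 + α) * √ε * 2 = 4 * α * √ε / (1 + α) := by ring
  have h4 : excess α * ε ≤ 4 * α * √ε / (1 + α) := by
    rw [le_div_iff₀ (by positivity)]
    have h5 := mul_le_mul_of_nonneg_left hsε (Real.sqrt_nonneg ε)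
    linear_combination h5 - (1 + α) * excess α * hsq
  linarith

lemma avgVol_nonneg : 0 ≤ avgVol G α ε s T := by
  unfold avgVol
  positivity

lemma runtime_le (hdeg : ∀ v, 0 < G.degree v) (h : IsEigendecomposition G E lam)
    (h0 : 0 < α) (h1 : α < 1) (hε0 : 0 < ε) (hε : ε ≤ 1 / (G.degree s : ℝ))
    (hT : IsLeast {t : ℕ | active G α ε s t = ∅} T) {N : ℕ∞} (hTN : (T : ℕ∞) ≤ N) {c : ℝ}
    (hc0 : 0 ≤ c) (hc2 : c < 2)
    (hgeom : geomMean (beta G α ε s E lam N) T = 1 + c * √α / (1 - √α)) :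
    runtime G α ε s T ≤ (1 + √α) * avgVol G α ε s T / (√α * (2 - c)) *
      (Real.log (2 * ySeq (beta G α ε s E lam N) (l2 (res G α ε s 0)) T / ε) +
        Real.log (excess α)) := by
  rw [runtime_eq_mul_avgVol (pos_of_isLeast hdeg h0 hε0 hε hT).ne']
  refine (mul_le_mul_of_nonneg_right (iterations_le hdeg h h0 h1 hε0 hε hT hTN hc0 hc2 hgeom)
    avgVol_nonneg).trans_eq ?_
  ring

lemma runtime_le_two_mul (hdeg : ∀ v, 0 < G.degree v) (h : IsEigendecomposition G E lam)
    (h0 : 0 < α) (h1 : α < 1) (hε0 : 0 < ε) (hε : ε ≤ 1 / (G.degree s : ℝ))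
    (hεt : ε ≤ tolerance α)
    (hT : IsLeast {t : ℕ | active G α ε s t = ∅} T) {N : ℕ∞} (hTN : (T : ℕ∞) ≤ N) {c : ℝ}
    (hc0 : 0 ≤ c) (hc2 : c < 2)
    (hgeom : geomMean (beta G α ε s E lam N) T = 1 + c * √α / (1 - √α)) :
    runtime G α ε s T ≤ 2 * ((1 + √α) * avgVol G α ε s T / (√α * (2 - c)) *
      Real.log (2 * ySeq (beta G α ε s E lam N) (l2 (res G α ε s 0)) T / ε)) := by
  have hco : 0 ≤ (1 + √α) * avgVol G α ε s T / (√α * (2 - c)) := by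
    have h2 : 0 < 2 - c := by linarith
    have := avgVol_nonneg (G := G) (α := α) (ε := ε) (s := s) (T := T)
    positivity
  have := mul_le_mul_of_nonneg_left (log_excess_le hdeg h0 h1 hε0 hε hεt
    (beta_nonneg (G := G) (α := α) (ε := ε) (s := s) (E := E) (lam := lam) N) T) hco
  have h2 := runtime_le hdeg h h0 h1 hε0 hε hT hTN hc0 hc2 hgeom
  linarith

lemma runtime_nonneg : 0 ≤ runtime G α ε s T := by
  unfold runtime
  positivity

end Runtime

/-! ### Total correctness with step counts -/

section Semantics

variable {V : Type*} [DecidableEq V] {nb : V → List V}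

/-- Total correctness with a bound on the number of steps. -/
def Terminates (nb : V → List V) (P : Prog) (σ : Mem V) (Q : Mem V → Prop) (n : ℕ) : Prop :=
  ∃ τ m, Run nb P σ τ m ∧ m ≤ n ∧ Q τ

lemma Terminates.mono {P : Prog} {σ : Mem V} {Q Q' : Mem V → Prop} {n n' : ℕ}
    (h : Terminates nb P σ Q n) (hQ : ∀ τ, Q τ → Q' τ) (hn : n ≤ n') :
    Terminates nb P σ Q' n' := by
  obtain ⟨τ, m, hr, hm, hq⟩ := h
  exact ⟨τ, m, hr, hm.trans hn, hQ τ hq⟩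

lemma Terminates.seq {P P' : Prog} {σ : Mem V} {Q R : Mem V → Prop} {n n' : ℕ}
    (h : Terminates nb P σ Q n) (h' : ∀ τ, Q τ → Terminates nb P' τ R n') :
    Terminates nb (.seq P P') σ R (n + n') := by
  obtain ⟨τ, m, hr, hm, hq⟩ := h
  obtain ⟨ρ, m', hr', hm', hq'⟩ := h' τ hq
  exact ⟨ρ, m + m', .seq _ _ _ _ _ _ _ hr hr', add_le_add hm hm', hq'⟩

/-- A loop that consumes its queue from the front. -/
lemma Terminates.loop {q : ℕ} {P : Prog} {I : List V → Mem V → Prop} {c : V → ℕ}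
    (hq : ∀ l σ, I l σ → σ.queue q = l)
    (h : ∀ v l σ, I (v :: l) σ → Terminates nb P σ (I l) (c v)) (l : List V) :
    ∀ σ, I l σ → Terminates nb (.loop q P) σ (I []) ((l.map fun v => c v + 1).sum + 1) := by
  induction l with
  | nil => exact fun σ hσ => ⟨σ, 1, .loopDone _ _ _ (hq _ _ hσ), by simp, hσ⟩
  | cons v l ih =>
    intro σ hσ
    obtain ⟨τ, m, hr, hm, hτ⟩ := h v l σ hσ
    obtain ⟨ρ, m', hr', hm', hρ⟩ := ih τ hτ
    refine ⟨ρ, m + m' + 1, .loopStep _ _ _ _ _ _ _ (by simp [hq _ _ hσ]) hr hr', ?_, hρ⟩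
    rw [List.map_cons, List.sum_cons]
    omega

/-- The contents of the part of the memory that the program uses. -/
structure Holds (σ : Mem V) (α ε δ δ' : ℝ) (x r d m : V → ℝ) (A B C D : List V) : Prop where
  reg0 : σ.reg 0 = α
  reg1 : σ.reg 1 = ε
  reg2 : σ.reg 2 = δ
  reg3 : σ.reg 3 = δ'
  arr0 : σ.arr 0 = x
  arr1 : σ.arr 1 = r
  arr2 : σ.arr 2 = d
  arr3 : σ.arr 3 = m
  queue0 : σ.queue 0 = A
  queue1 : σ.queue 1 = B
  queue2 : σ.queue 2 = C
  queue3 : σ.queue 3 = D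

/-- The indicator function of a list. -/
def indicator (l : List V) : V → ℝ := fun u => if u ∈ l then 1 else 0

lemma update_ite_mem (p : List V) (a b : V → ℝ) {v : V} {c : ℝ} (hc : c = a v) :
    Function.update (fun u => if u ∈ p then a u else b u) v c =
      fun u => if u ∈ p ∨ u = v then a u else b u := by
  ext u
  rcases eq_or_ne u v with rfl | hu <;> simp [*]

lemma update_indicator_cons {v : V} {l : List V} (h : v ∉ l) :
    Function.update (indicator (v :: l)) v 0 = indicator l := by
  ext u
  rcases eq_or_ne u v with rfl | hu <;> simp [indicator, *]

lemma update_indicator_append (l : List V) (v : V) :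
    Function.update (indicator l) v 1 = indicator (l ++ [v]) := by
  ext u
  rcases eq_or_ne u v with rfl | hu <;> simp [indicator, *]

end Semantics

/-! ### The program -/

section Program

/-- The contraction factor `(1-α)/(1+α)`. -/
def contractionExpr : Expr :=
  .div (.sub (.const 1) (.reg 0)) (.add (.const 1) (.reg 0))

/-- For every active node, compute the change of `x` and apply it; move the node to queue `1`. -/
def updateBody : Prog :=
  .seq (.pop 0 0) <|
  .seq (.setArr 2 0 (.add (.mul (.add (.const 1) (.mul (.reg 2) (.reg 3))) (.arr 1 0))
    (.mul (.mul (.reg 2) (.reg 3)) (.arr 2 0)))) <|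
  .seq (.setArr 0 0 (.add (.arr 0 0) (.arr 2 0))) <|
  .seq (.setArr 3 0 (.const 0)) (.push 1 0)

/-- Add to the residual at a neighbour the contribution of the change at the node of pointer `0`. -/
def spreadBody : Prog :=
  .seq (.pop 2 1) (.setArr 1 1 (.add (.arr 1 1)
    (.div (.mul contractionExpr (.arr 2 0)) (.mul (.sqrt (.deg 0)) (.sqrt (.deg 1))))))

/-- Subtract the change at a node from the residual, and collect the node and its neighbours in
queue `3`, its neighbours also in queue `2`. -/
def collectBody : Prog :=
  .seq (.pop 1 0) <|
  .seq (.setArr 1 0 (.sub (.arr 1 0) (.arr 2 0))) <|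
  .seq (.push 3 0) <|
  .seq (.pushNbrs 3 0) (.pushNbrs 2 0)

/-- Update the residual after a change at a node. -/
def residualBody : Prog := .seq collectBody (.loop 2 spreadBody)

/-- The threshold at the node of pointer `0`. -/
def thresholdExpr : Expr :=
  .div (.mul (.mul (.mul (.const 2) (.reg 0)) (.reg 1)) (.sqrt (.deg 0)))
    (.add (.const 1) (.reg 0))

/-- Enqueue a candidate in queue `0` if it is active and not there yet, and reset its last change
if it is not active. -/
def scanBody : Prog :=
  .seq (.pop 3 0) <|
  .ite thresholdExpr (.abs (.arr 1 0))
    (.ite (.const 1) (.arr 3 0) .skip (.seq (.setArr 3 0 (.const 1)) (.push 0 0)))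
    (.setArr 2 0 (.const 0))

/-- Advance the Chebyshev coefficients. -/
def coefficientStep : Prog :=
  .seq (.setReg 2 (.reg 3)) (.setReg 3 (.div (.const 1) (.sub (.mul (.const 2)
    (.div (.add (.const 1) (.reg 0)) (.sub (.const 1) (.reg 0)))) (.reg 3))))

/-- One iteration of the method. -/
def iterationBody : Prog :=
  .seq (.loop 0 updateBody) (.seq (.loop 1 residualBody) (.seq (.loop 3 scanBody) coefficientStep))

/-- Initialization at the source node. -/
def initialization : Prog :=
  .seq (.setReg 3 contractionExpr) <|
  .seq (.setArr 1 0 (.mul (.div (.mul (.const 2) (.reg 0)) (.add (.const 1) (.reg 0)))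
    (.div (.const 1) (.sqrt (.deg 0))))) <|
  .seq (.setArr 3 0 (.const 1)) (.push 0 0)

/-- The local Chebyshev method. -/
def localChebyshev : Prog := .seq initialization (.loop 0 iterationBody)

end Program

/-! ### Correctness and cost of the loops -/

section Correctness

variable {V : Type*} [DecidableEq V] {nb : V → List V} {α ε δ δ' : ℝ} {x r d m : V → ℝ}
  {A B C D : List V}

/-- The change of `x` at an active node. -/
def changeAt (δ δ' : ℝ) (r d : V → ℝ) (u : V) : ℝ := (1 + δ * δ') * r u + δ * δ' * d u

/-- The invariant splits `A` into a processed part `p` and the remaining queue `l`. As no node is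
repeated, the values read at the next node are still the old ones. -/
lemma terminates_updateLoop (hA : A.Nodup) {σ : Mem V}
    (h : Holds σ α ε δ δ' x r d (indicator A) A [] [] []) :
    Terminates nb (.loop 0 updateBody) σ
      (fun τ => Holds τ α ε δ δ' (fun u => if u ∈ A then x u + changeAt δ δ' r d u else x u) r
        (fun u => if u ∈ A then changeAt δ δ' r d u else d u) (indicator []) [] A [] [])
      (31 * A.length + 1) := by
  set I : List V → Mem V → Prop := fun l τ => ∃ p, A = p ++ l ∧
    Holds τ α ε δ δ' (fun u => if u ∈ p then x u + changeAt δ δ' r d u else x u) r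
      (fun u => if u ∈ p then changeAt δ δ' r d u else d u) (indicator l) l p [] [] with hI
  refine (Terminates.loop (I := I) (c := fun _ => 30) (fun l τ ⟨p, _, hτ⟩ => hτ.queue0) ?_ A σ
    ⟨[], rfl, by simpa using h⟩).mono ?_ (by simp [mul_comm])
  · rintro v l τ ⟨p, hp, hτ⟩
    have hnd := hp ▸ hA
    have hvp : v ∉ p := fun hv => (List.nodup_append.1 hnd).2.2 v hv v (by simp) rfl
    have hvl : v ∉ l := (List.nodup_cons.1 (List.nodup_append.1 hnd).2.1).1
    refine ⟨_, _, .seq _ _ _ _ _ _ _ (.pop _ _ _ v l hτ.queue0) <|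
      .seq _ _ _ _ _ _ _ (.setArr _ _ _ _) <| .seq _ _ _ _ _ _ _ (.setArr _ _ _ _) <|
      .seq _ _ _ _ _ _ _ (.setArr _ _ _ _) (.push _ _ _), by simp [Expr.cost], p ++ [v],
      by simp [hp], ?_⟩
    constructor <;> simp only [Function.update_apply, Expr.eval, hτ.reg0, hτ.reg1, hτ.reg2,
      hτ.reg3, hτ.arr0, hτ.arr1, hτ.arr2, hτ.arr3, hτ.queue1, hτ.queue2, hτ.queue3] <;>
      norm_num [hvp]
    · exact update_ite_mem p (fun u => x u + changeAt δ δ' r d u) x rfl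
    · exact update_ite_mem p (changeAt δ δ' r d) d rfl
    · exact update_indicator_cons hvl
  · rintro τ ⟨p, hp, hτ⟩
    rw [List.append_nil] at hp
    rwa [hp]

/-- The contribution to the residual at `v` of a change `d u` at a neighbour `u`. -/
noncomputable def spreadAt (nb : V → List V) (α : ℝ) (d : V → ℝ) (u v : V) : ℝ :=
  (1 - α) / (1 + α) * d u / (√((nb u).length) * √((nb v).length))

lemma terminates_spreadLoop {L : List V} (hL : L.Nodup) (u : V) {σ : Mem V} (hu : σ.ptr 0 = u)
    (h : Holds σ α ε δ δ' x r d m A B L D) :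
    Terminates nb (.loop 2 spreadBody) σ
      (fun τ => Holds τ α ε δ δ' x
        (fun v => if v ∈ L then r v + spreadAt nb α d u v else r v) d m A B [] D)
      (31 * L.length + 1) := by
  set I : List V → Mem V → Prop := fun l τ => ∃ p, L = p ++ l ∧ τ.ptr 0 = u ∧
    Holds τ α ε δ δ' x (fun v => if v ∈ p then r v + spreadAt nb α d u v else r v) d m A B l D
    with hI
  refine (Terminates.loop (I := I) (c := fun _ => 30) (fun l τ ⟨p, _, _, hτ⟩ => hτ.queue2) ?_ L σ
    ⟨[], rfl, hu, by simpa using h⟩).mono ?_ (by simp [mul_comm])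
  · rintro v l τ ⟨p, hp, hpu, hτ⟩
    have hnd := hp ▸ hL
    have hvp : v ∉ p := fun hv => (List.nodup_append.1 hnd).2.2 v hv v (by simp) rfl
    refine ⟨_, _, .seq _ _ _ _ _ _ _ (.pop _ _ _ v l hτ.queue2) (.setArr _ _ _ _),
      by simp [Expr.cost, contractionExpr], p ++ [v], by simp [hp], by simp [hpu], ?_⟩
    constructor <;> simp only [Function.update_apply, Expr.eval, contractionExpr, hτ.reg0, hτ.reg1,
      hτ.reg2, hτ.reg3, hτ.arr0, hτ.arr1, hτ.arr2, hτ.arr3, hτ.queue0, hτ.queue1, hτ.queue3,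
      hpu] <;> norm_num [hvp]
    exact update_ite_mem p (fun v => r v + spreadAt nb α d u v) r rfl
  · rintro τ ⟨p, hp, -, hτ⟩
    rw [List.append_nil] at hp
    rwa [hp]

/-- The change of the residual at `v` caused by a change `d u` at `u`. -/
noncomputable def residualChange (nb : V → List V) (α : ℝ) (d : V → ℝ) (u v : V) : ℝ :=
  (if v ∈ nb u then spreadAt nb α d u v else 0) - if v = u then d u else 0

lemma terminates_residualLoop (hnb : ∀ u, (nb u).Nodup) {σ : Mem V}
    (h : Holds σ α ε δ δ' x r d m A B [] []) :
    Terminates nb (.loop 1 residualBody) σ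
      (fun τ => Holds τ α ε δ δ' x
        (fun v => r v + (B.map fun u => residualChange nb α d u v).sum) d m A [] []
        (B.flatMap fun u => u :: nb u))
      ((B.map fun u => 33 * (nb u).length + 12 + 1).sum + 1) := by
  set I : List V → Mem V → Prop := fun l τ => ∃ p, B = p ++ l ∧
    Holds τ α ε δ δ' x (fun v => r v + (p.map fun u => residualChange nb α d u v).sum) d m A l []
      (p.flatMap fun u => u :: nb u)
    with hI
  refine (Terminates.loop (I := I) (c := fun u => 33 * (nb u).length + 12)
    (fun l τ ⟨p, _, hτ⟩ => hτ.queue1) ?_ B σ ⟨[], rfl, by simpa using h⟩).mono ?_ le_rfl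
  · rintro u l τ ⟨p, hp, hτ⟩
    set r' : V → ℝ := fun v => r v + (p.map fun u => residualChange nb α d u v).sum with hr'
    have hcollect : Terminates nb collectBody τ (fun τ => τ.ptr 0 = u ∧
          Holds τ α ε δ δ' x (fun v => r' v - if v = u then d u else 0) d m A l (nb u)
            ((p ++ [u]).flatMap fun u => u :: nb u)) (2 * (nb u).length + 8) := by
      refine ⟨_, _, .seq _ _ _ _ _ _ _ (.pop _ _ _ u l hτ.queue1) <|
        .seq _ _ _ _ _ _ _ (.setArr _ _ _ _) <| .seq _ _ _ _ _ _ _ (.push _ _ _) <|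
        .seq _ _ _ _ _ _ _ (.pushNbrs _ _ _) (.pushNbrs _ _ _), ?_, by simp, ?_⟩
      · simp [Expr.cost]; omega
      · constructor <;> simp only [Function.update_apply, Expr.eval, hτ.reg0, hτ.reg1, hτ.reg2,
          hτ.reg3, hτ.arr0, hτ.arr1, hτ.arr2, hτ.arr3, hτ.queue0, hτ.queue2, hτ.queue3] <;>
          norm_num
        ext v
        rcases eq_or_ne v u with rfl | hv <;> simp [*]
    refine (hcollect.seq fun τ' hτ' => terminates_spreadLoop (hnb u) u hτ'.1 hτ'.2).mono
      (fun τ' hτ' => ⟨p ++ [u], by simp [hp], ?_⟩) (by omega)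
    convert hτ' using 1
    ext v
    simp only [hr', residualChange, List.map_append, List.sum_append, List.map_cons, List.map_nil,
      List.sum_singleton]
    split_ifs <;> ring
  · rintro τ ⟨p, hp, hτ⟩
    rw [List.append_nil] at hp
    rwa [hp]

/-- A node is active for the residual `r`. -/
def IsActive (nb : V → List V) (α ε : ℝ) (r : V → ℝ) (u : V) : Prop :=
  2 * α * ε * √((nb u).length) / (1 + α) ≤ |r u|

-- Candidates may be repeated in `D`. The marks in array `3` decide membership in queue `0` at
-- constant cost, so each active node is enqueued once.
open Classical in
lemma terminates_scanLoop {σ : Mem V}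
    (h : Holds σ α ε δ δ' x r d (indicator []) [] [] [] D) :
    Terminates nb (.loop 3 scanBody) σ
      (fun τ => ∃ A : List V, A.Nodup ∧ (∀ u, u ∈ A ↔ u ∈ D ∧ IsActive nb α ε r u) ∧
        Holds τ α ε δ δ' x r (fun u => if u ∈ D ∧ ¬ IsActive nb α ε r u then 0 else d u)
          (indicator A) A [] [] [])
      (31 * D.length + 1) := by
  set I : List V → Mem V → Prop := fun l τ => ∃ p, D = p ++ l ∧ ∃ A : List V, A.Nodup ∧
    (∀ u, u ∈ A ↔ u ∈ p ∧ IsActive nb α ε r u) ∧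
      Holds τ α ε δ δ' x r (fun u => if u ∈ p ∧ ¬ IsActive nb α ε r u then 0 else d u)
        (indicator A) A [] [] l with hI
  refine (Terminates.loop (I := I) (c := fun _ => 30)
    (fun l τ ⟨p, _, A, _, _, hτ⟩ => hτ.queue3) ?_ D σ
    ⟨[], rfl, [], List.nodup_nil, by simp, by simpa using h⟩).mono ?_ (by simp [mul_comm])
  · rintro v l τ ⟨p, hp, A, hA, hmem, hτ⟩
    by_cases hv : IsActive nb α ε r v
    · have hd : (fun u => if u ∈ p ∧ ¬ IsActive nb α ε r u then 0 else d u) =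
          fun u => if u ∈ p ++ [v] ∧ ¬ IsActive nb α ε r u then 0 else d u := by
        ext u
        rcases eq_or_ne u v with rfl | hu <;> simp [*]
      by_cases hvA : v ∈ A
      · refine ⟨_, _, .seq _ _ _ _ _ _ _ (.pop _ _ _ v l hτ.queue3) <|
          .iteTrue _ _ _ _ _ _ _ ?_ <| .iteTrue _ _ _ _ _ _ _ ?_ (.skip _), ?_, p ++ [v],
          by simp [hp], A, hA, ?_, ?_⟩
        · simpa [thresholdExpr, Expr.eval, hτ.reg0, hτ.reg1, hτ.arr1, IsActive] using hv
        · simp [Expr.eval, hτ.arr3, indicator, hvA]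
        · simp [Expr.cost, thresholdExpr]
        · intro u
          rcases eq_or_ne u v with rfl | hu
          · simp [hvA, hv]
          · simp [*]
        · rw [← hd]
          constructor <;> simp [hτ.reg0, hτ.reg1, hτ.reg2, hτ.reg3, hτ.arr0, hτ.arr1, hτ.arr2,
            hτ.arr3, hτ.queue0, hτ.queue1, hτ.queue2]
      · refine ⟨_, _, .seq _ _ _ _ _ _ _ (.pop _ _ _ v l hτ.queue3) <|
          .iteTrue _ _ _ _ _ _ _ ?_ <| .iteFalse _ _ _ _ _ _ _ ?_ <|
          .seq _ _ _ _ _ _ _ (.setArr _ _ _ _) (.push _ _ _), ?_, p ++ [v],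
          by simp [hp], A ++ [v], ?_, ?_, ?_⟩
        · simpa [thresholdExpr, Expr.eval, hτ.reg0, hτ.reg1, hτ.arr1, IsActive] using hv
        · simp [Expr.eval, hτ.arr3, indicator, hvA]
        · simp [Expr.cost, thresholdExpr]
        · exact List.nodup_append.2 ⟨hA, by simp, by
            rintro a ha b hb rfl
            exact hvA (List.mem_singleton.1 hb ▸ ha)⟩
        · intro u
          rcases eq_or_ne u v with rfl | hu <;> simp [*]
        · rw [← hd]
          constructor <;> simp [Expr.eval, hτ.reg0, hτ.reg1, hτ.reg2, hτ.reg3, hτ.arr0, hτ.arr1,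
            hτ.arr2, hτ.arr3, hτ.queue0, hτ.queue1, hτ.queue2, update_indicator_append]
    · refine ⟨_, _, .seq _ _ _ _ _ _ _ (.pop _ _ _ v l hτ.queue3) <|
        .iteFalse _ _ _ _ _ _ _ ?_ (.setArr _ _ _ _), ?_, p ++ [v],
        by simp [hp], A, hA, ?_, ?_⟩
      · simpa [thresholdExpr, Expr.eval, hτ.reg0, hτ.reg1, hτ.arr1, IsActive] using hv
      · simp [Expr.cost, thresholdExpr]
      · intro u
        rcases eq_or_ne u v with rfl | hu <;> simp [*]
      · constructor <;> simp [Expr.eval, hτ.reg0, hτ.reg1, hτ.reg2, hτ.reg3, hτ.arr0, hτ.arr1,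
            hτ.arr2, hτ.arr3, hτ.queue0, hτ.queue1, hτ.queue2]
        ext u
        rcases eq_or_ne u v with rfl | hu <;> simp [*]
  · rintro τ ⟨p, hp, A, hA, hmem, hτ⟩
    rw [List.append_nil] at hp
    subst hp
    exact ⟨A, hA, hmem, hτ⟩

lemma terminates_coefficientStep {σ : Mem V}
    (h : Holds σ α ε δ δ' x r d m A B C D) :
    Terminates nb coefficientStep σ
      (fun τ => Holds τ α ε δ' (2 * ((1 + α) / (1 - α)) - δ')⁻¹ x r d m A B C D) 20 := by
  refine ⟨_, _, .seq _ _ _ _ _ _ _ (.setReg _ _ _) (.setReg _ _ _), by simp [Expr.cost], ?_⟩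
  constructor <;> simp [Expr.eval, h.reg0, h.reg1, h.reg3, h.arr0, h.arr1,
    h.arr2, h.arr3, h.queue0, h.queue1, h.queue2, h.queue3]

lemma terminates_initialization (s : V) :
    Terminates nb initialization (initMem α ε s)
      (fun τ => Holds τ α ε 0 ((1 - α) / (1 + α)) 0
        (Pi.single s (2 * α / (1 + α) * (√((nb s).length))⁻¹)) 0 (indicator [s]) [s] [] [] [])
      30 := by
  refine ⟨_, _, .seq _ _ _ _ _ _ _ (.setReg _ _ _) <|
    .seq _ _ _ _ _ _ _ (.setArr _ _ _ _) <| .seq _ _ _ _ _ _ _ (.setArr _ _ _ _) (.push _ _ _),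
    by simp [Expr.cost, contractionExpr], ?_⟩
  constructor <;> simp [Expr.eval, contractionExpr, initMem]
  · rfl
  · ext u
    simp [Pi.single_apply, Function.update_apply]
  · rfl
  · ext u
    simp [indicator, Function.update_apply]

end Correctness

/-! ### The program implements LocCH -/

section Implementation

variable {V : Type*} [Fintype V] [DecidableEq V] {G : SimpleGraph V} [DecidableRel G.Adj]
  {nb : V → List V} {α ε : ℝ} {s : V}

lemma IsAdjList.length_eq_degree (h : IsAdjList G nb) (u : V) : (nb u).length = G.degree u := by
  rw [← List.toFinset_card_of_nodup (h u).1, ← G.card_neighborFinset_eq_degree]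
  congr 1
  ext v
  rw [List.mem_toFinset, (h u).2, G.mem_neighborFinset]

/-- Step `0` fits the general form because `δ_0 = 0` and `r^(0)` is supported on `S_0`; the
truncated `t - 1` is then harmless. -/
lemma iter_succ_apply (hdeg : ∀ v, 0 < G.degree v) (h0 : 0 < α) (hε0 : 0 < ε)
    (hε : ε ≤ 1 / (G.degree s : ℝ)) (t : ℕ) (u : V) :
    iter G α ε s (t + 1) u =
      if u ∈ active G α ε s t then
        iter G α ε s t u + changeAt (delta α t) (delta α (t + 1)) (res G α ε s t)
          (restrict (active G α ε s t) (iter G α ε s t - iter G α ε s (t - 1))) u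
      else iter G α ε s t u := by
  rcases t with _ | t
  · have h1 : iter G α ε s (0 + 1) = res G α ε s 0 := rfl
    rw [h1, ← restrict_active_zero hdeg h0 hε0 hε, restrict_apply]
    simp [changeAt, delta, iter, restrict_active_zero hdeg h0 hε0 hε]
  · have h : iter G α ε s (t + 2) = iter G α ε s (t + 1) +
        ((1 + delta α (t + 1) * delta α (t + 2)) •
            restrict (active G α ε s (t + 1)) (res G α ε s (t + 1)) +
          (delta α (t + 1) * delta α (t + 2)) •
            restrict (active G α ε s (t + 1)) (iter G α ε s (t + 1) - iter G α ε s t)) := rfl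
    rw [h]
    by_cases hu : u ∈ active G α ε s (t + 1) <;> simp [restrict_apply, hu, changeAt]

lemma res_succ_apply (hnb : IsAdjList G nb) (t : ℕ) {A : List V} (hA : A.Nodup)
    (hd : ∀ u, u ∉ A → (iter G α ε s (t + 1) - iter G α ε s t) u = 0) (v : V) :
    res G α ε s (t + 1) v = res G α ε s t v +
      (A.map fun u => residualChange nb α (iter G α ε s (t + 1) - iter G α ε s t) u v).sum := by
  rw [res_succ]
  set d := iter G α ε s (t + 1) - iter G α ε s t with hdd
  have h1 : (A.map fun u => residualChange nb α d u v).sum = ∑ u, residualChange nb α d u v := by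
    rw [← List.sum_toFinset _ hA]
    refine sum_subset (subset_univ _) fun u _ hu => ?_
    rw [List.mem_toFinset] at hu
    simp [residualChange, spreadAt, hd u hu]
  have h2 : ∑ u, residualChange nb α d u v =
      (1 - α) / (1 + α) * (normAdj G *ᵥ d) v - d v := by
    simp only [residualChange, sum_sub_distrib, sum_ite_eq, mem_univ, if_true]
    rw [normAdj_mulVec, mul_sum, mul_sum, ← sum_filter]
    congr 1
    refine sum_congr ?_ fun u _ => ?_
    · ext u
      rw [mem_filter, (hnb u).2, G.mem_neighborFinset, G.adj_comm]
      simp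
    · rw [spreadAt, hnb.length_eq_degree, hnb.length_eq_degree, div_eq_mul_inv _ (_ * _), mul_inv]
      ring
  rw [h1, h2]
  simp only [Pi.add_apply, Pi.sub_apply, Pi.smul_apply, smul_eq_mul]
  ring

variable (G α ε s) in
/-- The memory represents the state of the method before iteration `t`. -/
def AtIteration (t : ℕ) (σ : Mem V) : Prop :=
  ∃ A : List V, A.Nodup ∧ (∀ u, u ∈ A ↔ u ∈ active G α ε s t) ∧
    Holds σ α ε (delta α t) (delta α (t + 1)) (iter G α ε s t) (res G α ε s t)
      (restrict (active G α ε s t) (iter G α ε s t - iter G α ε s (t - 1))) (indicator A)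
      A [] [] []

lemma isActive_iff (hnb : IsAdjList G nb) {t : ℕ} {u : V} :
    IsActive nb α ε (res G α ε s t) u ↔ u ∈ active G α ε s t := by
  rw [IsActive, mem_active, hnb.length_eq_degree]

lemma terminates_iterationBody (hdeg : ∀ v, 0 < G.degree v) (h0 : 0 < α) (hε0 : 0 < ε)
    (hε : ε ≤ 1 / (G.degree s : ℝ)) (hnb : IsAdjList G nb) {t : ℕ}
    (hne : (active G α ε s t).Nonempty) {σ : Mem V} (hσ : AtIteration G α ε s t σ) :
    Terminates nb iterationBody σ (AtIteration G α ε s (t + 1))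
      (162 * vol G (active G α ε s t)) := by
  classical
  obtain ⟨A, hA, hmem, hσ⟩ := hσ
  set S := active G α ε s t with hS
  set d := iter G α ε s (t + 1) - iter G α ε s t with hd
  have hAS : A.toFinset = S := by ext u; rw [List.mem_toFinset, hmem]
  have hx : (fun u => if u ∈ A then iter G α ε s t u + changeAt (delta α t) (delta α (t + 1))
      (res G α ε s t) (restrict S (iter G α ε s t - iter G α ε s (t - 1))) u
      else iter G α ε s t u) = iter G α ε s (t + 1) := by
    ext u
    rw [iter_succ_apply hdeg h0 hε0 hε]
    simp only [hmem, hS]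
  have hd1 : (fun u => if u ∈ A then changeAt (delta α t) (delta α (t + 1))
      (res G α ε s t) (restrict S (iter G α ε s t - iter G α ε s (t - 1))) u
      else restrict S (iter G α ε s t - iter G α ε s (t - 1)) u) = d := by
    ext u
    rw [hd, Pi.sub_apply, iter_succ_apply hdeg h0 hε0 hε]
    by_cases hu : u ∈ S
    · simp [hmem, ← hS, hu]
    · simp [hmem, ← hS, hu, restrict_apply]
  have hdA : ∀ u, u ∉ A → d u = 0 := fun u hu => by
    rw [hmem] at hu
    rw [hd, Pi.sub_apply, iter_succ_apply hdeg h0 hε0 hε, ← hS, if_neg hu, sub_self]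
  have hr : (fun v => res G α ε s t v + (A.map fun u => residualChange nb α d u v).sum) =
      res G α ε s (t + 1) := by
    ext v
    rw [res_succ_apply hnb t hA hdA]
  set D := A.flatMap fun u => u :: nb u with hD
  have hAD : ∀ u ∈ A, u ∈ D := fun u hu => List.mem_flatMap.2 ⟨u, hu, List.mem_cons_self⟩
  -- Off `D` the residual is unchanged and was below the threshold.
  have hSD : ∀ u, u ∈ active G α ε s (t + 1) → u ∈ D := by
    intro u hu
    by_contra huD
    have huA : u ∉ A := fun h => huD (hAD u h)
    have hru : res G α ε s (t + 1) u = res G α ε s t u := by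
      rw [← hr]
      have : (A.map fun w => residualChange nb α d w u).sum = 0 := by
        refine List.sum_eq_zero fun z hz => ?_
        obtain ⟨w, hw, rfl⟩ := List.mem_map.1 hz
        have h1 : u ∉ nb w := fun h => huD (List.mem_flatMap.2 ⟨w, hw, List.mem_cons_of_mem _ h⟩)
        have h2 : u ≠ w := fun h => huA (h ▸ hw)
        simp [residualChange, h1, h2]
      simp [this]
    rw [mem_active, hru, ← mem_active, ← hmem] at hu
    exact huA hu
  have hlen : (A.map fun u => (nb u).length).sum = vol G S := by
    rw [← List.sum_toFinset _ hA, hAS, vol]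
    exact sum_congr rfl fun u _ => hnb.length_eq_degree u
  have hcard : A.length ≤ vol G S := by
    rw [← List.toFinset_card_of_nodup hA, hAS, vol, card_eq_sum_ones]
    exact sum_le_sum fun u _ => hdeg u
  have hpos : 1 ≤ A.length := by
    rw [← List.toFinset_card_of_nodup hA, hAS]
    exact hne.card_pos
  have hDlen : D.length = A.length + vol G S := by
    rw [hD, List.length_flatMap, ← hlen]
    simp only [List.length_cons, List.sum_map_add]
    simp [add_comm]
  have hcost : (A.map fun u => 33 * (nb u).length + 12 + 1).sum =
      33 * vol G S + 13 * A.length := by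
    rw [← hlen]
    simp only [add_assoc, List.sum_map_add, List.sum_map_mul_left]
    simp [mul_comm]
    ring
  -- The total is `75 |A| + 64 vol + 23`, and `1 ≤ |A| ≤ vol` gives `162 vol`.
  refine (Terminates.seq (terminates_updateLoop hA hσ) fun τ hτ => ?_).mono (fun _ h => h)
    (n := 31 * A.length + 1 + (((A.map fun u => 33 * (nb u).length + 12 + 1).sum + 1) +
      ((31 * D.length + 1) + 20))) (by omega)
  rw [hx, hd1] at hτ
  refine (terminates_residualLoop (fun u => (hnb u).1) hτ).seq fun τ hτ => ?_
  rw [hr] at hτ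
  refine (terminates_scanLoop hτ).seq fun τ hτ => ?_
  obtain ⟨A', hA', hmem', hτ⟩ := hτ
  refine (terminates_coefficientStep hτ).mono (fun τ hτ => ⟨A', hA', fun u => ?_, ?_⟩) le_rfl
  · rw [hmem', isActive_iff hnb]
    exact ⟨And.right, fun h => ⟨hSD u h, h⟩⟩
  -- Resetting array `2` within `D` suffices, because `d` already vanishes elsewhere.
  · have hd' : (fun u => if u ∈ D ∧ ¬ IsActive nb α ε (res G α ε s (t + 1)) u then 0 else d u) =
        restrict (active G α ε s (t + 1)) d := by
      ext u
      rw [restrict_apply, isActive_iff hnb]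
      by_cases hu : u ∈ active G α ε s (t + 1)
      · simp [hu]
      · by_cases huD : u ∈ D
        · simp [hu, huD]
        · simp [hu, huD, hdA u fun h => huD (hAD u h)]
    rw [hd'] at hτ
    exact hτ

lemma terminates_mainLoop (hdeg : ∀ v, 0 < G.degree v) (h0 : 0 < α) (hε0 : 0 < ε)
    (hε : ε ≤ 1 / (G.degree s : ℝ)) (hnb : IsAdjList G nb) {T : ℕ}
    (hT : IsLeast {t : ℕ | active G α ε s t = ∅} T) (n : ℕ) :
    ∀ t, t + n = T → ∀ σ : Mem V, AtIteration G α ε s t σ →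
      Terminates nb (.loop 0 iterationBody) σ (AtIteration G α ε s T)
        (163 * ∑ i ∈ Ico t T, vol G (active G α ε s i) + 1) := by
  induction n with
  | zero =>
    rintro t rfl σ hσ
    refine ⟨σ, 1, .loopDone _ _ _ ?_, by simp, hσ⟩
    obtain ⟨A, -, hmem, hσ⟩ := hσ
    rw [hσ.queue0, List.eq_nil_iff_forall_not_mem]
    intro u
    have : active G α ε s t = ∅ := hT.1
    rw [hmem, this]
    exact notMem_empty u
  | succ n ih =>
    rintro t ht σ hσ
    have hlt : t < T := by omega
    have hne := active_nonempty_of_isLeast hT hlt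
    obtain ⟨τ, m, hr, hm, hτ⟩ := terminates_iterationBody hdeg h0 hε0 hε hnb hne hσ
    obtain ⟨ρ, m', hr', hm', hρ⟩ := ih (t + 1) (by omega) τ hτ
    refine ⟨ρ, m + m' + 1, .loopStep _ _ _ _ _ _ _ ?_ hr hr', ?_, hρ⟩
    · obtain ⟨u, hu⟩ := hne
      obtain ⟨A, -, hmem, hσ⟩ := hσ
      rw [hσ.queue0]
      exact List.ne_nil_of_mem ((hmem u).2 hu)
    · have hv : 1 ≤ vol G (active G α ε s t) := by
        obtain ⟨u, hu⟩ := hne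
        exact (hdeg u).trans_le (single_le_sum (f := fun v => G.degree v)
          (fun _ _ => Nat.zero_le _) hu)
      rw [sum_eq_sum_Ico_succ_bot hlt]
      omega

lemma implements_localChebyshev (hdeg : ∀ v, 0 < G.degree v) (h0 : 0 < α) (hε0 : 0 < ε)
    (hε : ε ≤ 1 / (G.degree s : ℝ)) {T : ℕ} (hT : IsLeast {t : ℕ | active G α ε s t = ∅} T) :
    Implements localChebyshev G α ε s T (200 * runtime G α ε s T) := by
  intro nb hnb
  have hstart : ∀ τ : Mem V, Holds τ α ε 0 ((1 - α) / (1 + α)) 0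
      (Pi.single s (2 * α / (1 + α) * (√((nb s).length))⁻¹)) 0 (indicator [s]) [s] [] [] [] →
      AtIteration G α ε s 0 τ := by
    intro τ hτ
    refine ⟨[s], List.nodup_singleton s, fun u => ?_, ?_⟩
    · rw [active_zero hdeg h0 hε0 hε]
      simp
    · have hd : restrict (active G α ε s 0) (iter G α ε s 0 - iter G α ε s (0 - 1)) = 0 := by
        ext u
        simp [restrict_apply]
      rw [hd, res_zero, ← hnb.length_eq_degree]
      exact hτ
  obtain ⟨τ, m, hrun, hm, hτ⟩ := (terminates_initialization s).seq fun τ hτ =>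
    terminates_mainLoop hdeg h0 hε0 hε hnb hT T 0 (zero_add T) τ (hstart τ hτ)
  obtain ⟨A, -, -, hτ⟩ := hτ
  refine ⟨τ, m, hrun, hτ.arr0, hτ.arr1, ?_⟩
  have hsum : 1 ≤ ∑ i ∈ Ico 0 T, vol G (active G α ε s i) := by
    have hTpos := pos_of_isLeast hdeg h0 hε0 hε hT
    refine le_trans ?_ (single_le_sum (f := fun i => vol G (active G α ε s i))
      (fun _ _ => Nat.zero_le _) (mem_Ico.2 ⟨le_rfl, hTpos⟩))
    rw [active_zero hdeg h0 hε0 hε, vol, sum_singleton]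
    exact hdeg s
  -- Initialization and the final loop test cost at most `31`, charged to `vol(S_0) ≥ 1`.
  have hm' : m ≤ 200 * ∑ i ∈ Ico 0 T, vol G (active G α ε s i) := by omega
  rw [runtime, range_eq_Ico]
  exact_mod_cast hm'

lemma Implements.mono {P : Prog} {T : ℕ} {n n' : ℝ} (h : Implements P G α ε s T n) (hn : n ≤ n') :
    Implements P G α ε s T n' := by
  intro nb hnb
  obtain ⟨τ, m, hr, hx, hr', hm⟩ := h nb hnb
  exact ⟨τ, m, hr, hx, hr', hm.trans hn⟩

end Implementation

end LocCH

theorem mainTheorem1 :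
    -- the residual bound
    (∀ (V : Type*) [Fintype V] [DecidableEq V] (G : SimpleGraph V) [DecidableRel G.Adj]
      (E : Matrix V V ℝ) (lam : V → ℝ) (α ε : ℝ) (s : V),
      (∀ v, 0 < G.degree v) → LocCH.IsEigendecomposition G E lam →
      0 < α → α < 1 → 0 < ε → ε ≤ 1 / (G.degree s : ℝ) →
      (∀ k : ℕ, BddAbove (Set.range fun t : ℕ => LocCH.betaAt G α ε s E lam k t)) ∧
      ∀ N : ℕ∞,
        (∀ t : ℕ, 0 < LocCH.ySeq (LocCH.beta G α ε s E lam N)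
          (LocCH.l2 (LocCH.res G α ε s 0)) t) ∧
        ∀ t : ℕ, 1 ≤ t → (t : ℕ∞) ≤ N →
          LocCH.l2 (LocCH.res G α ε s t) ≤
            LocCH.deltaProd α 1 t *
              (∏ j ∈ Finset.range t, (1 + LocCH.beta G α ε s E lam N j)) *
              LocCH.ySeq (LocCH.beta G α ε s E lam N) (LocCH.l2 (LocCH.res G α ε s 0)) t) ∧
    -- the implementation and the runtime bound
    (∃ (P : LocCH.Prog) (C : ℝ), 0 < C ∧ ∀ α : ℝ, 0 < α → α < 1 →
      ∃ ε₀ L : ℝ, 0 < ε₀ ∧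
      ∀ (V : Type*) [Fintype V] [DecidableEq V] (G : SimpleGraph V) [DecidableRel G.Adj]
        (E : Matrix V V ℝ) (lam : V → ℝ) (ε : ℝ) (s : V) (T : ℕ),
        (∀ v, 0 < G.degree v) → LocCH.IsEigendecomposition G E lam →
        0 < ε → ε ≤ 1 / (G.degree s : ℝ) →
        IsLeast {t : ℕ | LocCH.active G α ε s t = ∅} T →
        LocCH.Implements P G α ε s T (C * LocCH.runtime G α ε s T) ∧
        ∀ (N : ℕ∞) (c : ℝ), (T : ℕ∞) ≤ N → 0 ≤ c → c < 2 →
          LocCH.geomMean (LocCH.beta G α ε s E lam N) T =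
            1 + c * Real.sqrt α / (1 - Real.sqrt α) →
          (ε ≤ ε₀ →
            LocCH.runtime G α ε s T ≤
                C * ((1 + Real.sqrt α) * LocCH.avgVol G α ε s T / (Real.sqrt α * (2 - c)) *
                  Real.log (2 * LocCH.ySeq (LocCH.beta G α ε s E lam N)
                    (LocCH.l2 (LocCH.res G α ε s 0)) T / ε)) ∧
            LocCH.Implements P G α ε s T
              (C * ((1 + Real.sqrt α) * LocCH.avgVol G α ε s T / (Real.sqrt α * (2 - c)) *
                Real.log (2 * LocCH.ySeq (LocCH.beta G α ε s E lam N)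
                  (LocCH.l2 (LocCH.res G α ε s 0)) T / ε)))) ∧
          LocCH.runtime G α ε s T ≤
            (1 + Real.sqrt α) * LocCH.avgVol G α ε s T / (Real.sqrt α * (2 - c)) *
              (Real.log (2 * LocCH.ySeq (LocCH.beta G α ε s E lam N)
                (LocCH.l2 (LocCH.res G α ε s 0)) T / ε) + L)) := by
  -- `400 = 200 * 2`: the program costs a factor `200`, and absorbing `L` into the logarithm a
  -- factor `2`.
  refine ⟨fun V _ _ G _ E lam α ε s hdeg hE h0 h1 hε0 hε => ⟨fun k => ?_, fun N => ⟨fun t => ?_,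
    fun t _ htN => ?_⟩⟩, LocCH.localChebyshev, 400, by norm_num, fun α h0 h1 =>
    ⟨LocCH.tolerance α, Real.log (LocCH.excess α), LocCH.tolerance_pos h0 h1,
      fun V _ _ G _ E lam ε s T hdeg hE hε0 hε hT => ?_⟩⟩
  · exact LocCH.bddAbove_betaAt h0 h1 hE.1 (hE.abs_le_one hdeg) k
  · exact LocCH.ySeq_pos (LocCH.beta_nonneg N) (LocCH.l2_res_zero_pos hdeg h0) t
  · exact LocCH.l2_res_le hdeg hE h0 h1 hε0 hε htN
  · have himp := LocCH.implements_localChebyshev hdeg h0 hε0 hε hT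
    have hrun := LocCH.runtime_nonneg (G := G) (α := α) (ε := ε) (s := s) (T := T)
    refine ⟨himp.mono (by linarith), fun N c hTN hc0 hc2 hgeom => ⟨fun hεt => ?_,
      LocCH.runtime_le hdeg hE h0 h1 hε0 hε hT hTN hc0 hc2 hgeom⟩⟩
    have hle := LocCH.runtime_le_two_mul hdeg hE h0 h1 hε0 hε hεt hT hTN hc0 hc2 hgeom
    exact ⟨by linarith, himp.mono (by linarith)⟩
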